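/- Let $\{0,1\}^\omega$ be the Cantor set of infinite binary sequences with the product topology, and let $\{0,1\}^*$ be the set of finite binary sequences. An asynchronous binary transducer is a quadruple $(S,s_0,t,o)$ consisting of a finite set $S$ of states, an initial state $s_0\in S$, a transition function $t\colon S\times\{0,1\}\to S$ and an output function $o\colon S\times\{0,1\}\to\{0,1\}^*$. For $\psi=\sigma_1\sigma_2\cdots\in\{0,1\}^\omega$ put $s_1=s_0$, $s_{n+1}=t(s_n,\sigma_n)$ for $n\ge 1$, and let $o(s_0,\psi)=o(s_1,\sigma_1)\,o(s_2,\sigma_2)\cdots$ be the infinite concatenation of the outputs. A homeomorphism $f$ of $\{0,1\}^\omega$ is called rational if there is an asynchronous binary transducer $(S,s_0,t,o)$ such that $f(\psi)=o(s_0,\psi)$ for all $\psi\in\{0,1\}^\omega$. Theorem. The set $\mathcal R$ of all rational homeomorphisms of $\{0,1\}^\omega$ is a group under composition (the asynchronous rational group of Grigorchuk, Nekrashevych and Sushchanskii). The group $\mathcal R$ is simple, and it is not finitely generated. -/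

import Mathlib

/-- An asynchronous binary transducer with set of internal states `S`
(finiteness of `S` is required where transducers are used). -/
structure BinaryTransducer (S : Type) where
  /-- the initial state -/
  init : S
  /-- the transition function -/
  t : S → Bool → S
  /-- the output function, with values in the finite binary sequences -/
  o : S → Bool → List Bool

namespace BinaryTransducer

/-- The output function extended to finite binary sequences: the concatenation of the outputs
produced while reading the given word from the state `s`. -/
def output {S : Type} (T : BinaryTransducer S) : S → List Bool → List Bool
  | _, [] => []
  | s, σ :: w => T.o s σ ++ T.output (T.t s σ) w

end BinaryTransducer

/-- The finite sequence formed by the first `n` digits of `ψ`. -/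
def firstDigits (ψ : ℕ → Bool) (n : ℕ) : List Bool :=
  (List.range n).map ψ

namespace BinaryTransducer

/-- `T.OutputsOn s ψ x` says that the infinite concatenation `o(s, ψ)` is an infinite sequence
and is equal to `x`: the finite concatenations `o(s, ψ₁⋯ψₙ)` are all initial segments of `x`,
and their lengths are unbounded. -/
def OutputsOn {S : Type} (T : BinaryTransducer S) (s : S) (ψ x : ℕ → Bool) : Prop :=
  (∀ n : ℕ, T.output s (firstDigits ψ n) =
      firstDigits x (T.output s (firstDigits ψ n)).length) ∧
    ∀ m : ℕ, ∃ n : ℕ, m ≤ (T.output s (firstDigits ψ n)).length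

end BinaryTransducer

/-- A homeomorphism of the Cantor set `{0,1}^ω` (the product topology on `ℕ → Bool`) is rational
if it is computed by an asynchronous binary transducer with finitely many states. -/
def IsRationalHomeo (f : (ℕ → Bool) ≃ₜ (ℕ → Bool)) : Prop :=
  ∃ (S : Type) (_ : Finite S) (T : BinaryTransducer S),
    ∀ ψ : ℕ → Bool, T.OutputsOn T.init ψ (f ψ)

/-! Rationality is replaced by a condition without transducers: the maps `ψ ↦ f (w ψ)`, taken up to
a prefix of their values, are finitely many (`isRationalHomeo_iff`). The condition passes to
compositions and clopen gluings. It passes to inverses because a local action of `f⁻¹` is determined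
by a local action of `f` and a word of bounded length (`FiniteLocalActions.symm`).

Simplicity: let `M ≠ 1` be normalized by the group. A nontrivial element of `M` displaces some cone,
so a double commutator puts into `M` the copy on that cone of any commutator of rational
homeomorphisms. An infinite swindle writes the copy of an arbitrary `f` on a cone as a commutator
(`exists_commutator_eq_conePerm`). Proper cones are interchangeable, so `M` contains every element
that is the identity on some proper cone, and every `f ≠ 1` is a product of two such elements.

Infinite generation: near an eventually periodic point `x`, a rational `f` turns `j` extra periods
of `x` into `i` extra periods of `f x`. The ratio `i / j` depends only on the germ and is
multiplicative under composition. By pigeonhole, the primes occurring in the ratios of one `f` are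
bounded, uniformly in `x`. Hence finitely many generators involve only finitely many primes, whereas
`stretch k` has ratio `k + 1` at the constant sequence `1`. -/

open Set Filter Topology PiNat
open scoped commutatorElement

/-! ### Finite words, prefixes and tails -/

/-- The infinite sequence `w ψ`. -/
def prepend (w : List Bool) (ψ : ℕ → Bool) : ℕ → Bool :=
  fun n => if h : n < w.length then w[n] else ψ (n - w.length)

/-- The sequence `ψ` without its first `n` digits. -/
def shift (n : ℕ) (ψ : ℕ → Bool) : ℕ → Bool := fun m => ψ (n + m)

@[simp] theorem prepend_nil (ψ : ℕ → Bool) : prepend [] ψ = ψ := by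
  ext n; simp [prepend]

theorem prepend_append (u w : List Bool) (ψ : ℕ → Bool) :
    prepend (u ++ w) ψ = prepend u (prepend w ψ) := by
  ext n
  simp only [prepend, List.length_append, List.getElem_append]
  split_ifs <;> first | rfl | omega | (congr 1; omega)

theorem prepend_cons (σ : Bool) (w : List Bool) (ψ : ℕ → Bool) :
    prepend (σ :: w) ψ = prepend [σ] (prepend w ψ) :=
  prepend_append [σ] w ψ

theorem prepend_of_lt {w : List Bool} {n : ℕ} (h : n < w.length) (ψ : ℕ → Bool) :
    prepend w ψ n = w[n] := by simp [prepend, h]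

theorem prepend_of_le {w : List Bool} {n : ℕ} (h : w.length ≤ n) (ψ : ℕ → Bool) :
    prepend w ψ n = ψ (n - w.length) := by simp [prepend, Nat.not_lt.2 h]

@[simp] theorem prepend_singleton_zero (σ : Bool) (ψ : ℕ → Bool) : prepend [σ] ψ 0 = σ := rfl

@[simp] theorem prepend_singleton_succ (σ : Bool) (ψ : ℕ → Bool) (n : ℕ) :
    prepend [σ] ψ (n + 1) = ψ n := by simp [prepend]

@[simp] theorem shift_prepend (w : List Bool) (ψ : ℕ → Bool) :
    shift w.length (prepend w ψ) = ψ := by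
  ext n; simp [shift, prepend]

@[simp] theorem shift_one_prepend (σ : Bool) (ψ : ℕ → Bool) : shift 1 (prepend [σ] ψ) = ψ :=
  shift_prepend [σ] ψ

theorem shift_shift (m n : ℕ) (ψ : ℕ → Bool) : shift m (shift n ψ) = shift (n + m) ψ := by
  ext i; simp [shift, add_assoc]

theorem shift_succ (n : ℕ) : shift (n + 1) = shift 1 ∘ shift n := by
  ext ψ : 1; exact (shift_shift 1 n ψ).symm

@[simp] theorem shift_zero (ψ : ℕ → Bool) : shift 0 ψ = ψ := by
  ext n; simp [shift]

theorem prepend_injective (w : List Bool) : Function.Injective (prepend w) := fun ψ φ h => by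
  rw [← shift_prepend w ψ, h, shift_prepend]

theorem prepend_zero_shift (ψ : ℕ → Bool) : prepend [ψ 0] (shift 1 ψ) = ψ := by
  ext n; cases n <;> simp [shift, add_comm]

theorem exists_eq_cons (ψ : ℕ → Bool) : ∃ σ φ, ψ = prepend [σ] φ :=
  ⟨_, _, (prepend_zero_shift ψ).symm⟩

@[simp] theorem length_firstDigits (ψ : ℕ → Bool) (n : ℕ) : (firstDigits ψ n).length = n := by
  simp [firstDigits]

@[simp] theorem getElem_firstDigits (ψ : ℕ → Bool) (n i : ℕ) (h : i < (firstDigits ψ n).length) :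
    (firstDigits ψ n)[i] = ψ i := by
  simp [firstDigits]

theorem prepend_firstDigits_apply (ψ φ : ℕ → Bool) (n m : ℕ) :
    prepend (firstDigits ψ n) φ m = if m < n then ψ m else φ (m - n) := by
  simp [prepend]

@[simp] theorem prepend_firstDigits_shift (ψ : ℕ → Bool) (n : ℕ) :
    prepend (firstDigits ψ n) (shift n ψ) = ψ := by
  ext m
  rw [prepend_firstDigits_apply]
  split_ifs
  · rfl
  · simp only [shift]; congr 1; omega

theorem firstDigits_eq_iff {x y : ℕ → Bool} {n : ℕ} :
    firstDigits x n = firstDigits y n ↔ x ∈ cylinder y n := by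
  simp [firstDigits, mem_cylinder_iff]

theorem firstDigits_prepend (w : List Bool) (ψ : ℕ → Bool) :
    firstDigits (prepend w ψ) w.length = w := by
  apply List.ext_getElem (by simp)
  intro i h1 h2
  simp [prepend_of_lt h2]

theorem mem_range_prepend {w : List Bool} {x : ℕ → Bool} :
    x ∈ range (prepend w) ↔ firstDigits x w.length = w := by
  constructor
  · rintro ⟨ψ, rfl⟩
    exact firstDigits_prepend w ψ
  · intro h
    exact ⟨shift w.length x, by conv_lhs => rw [← h]
                                simp⟩

theorem range_prepend_firstDigits (x : ℕ → Bool) (n : ℕ) :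
    range (prepend (firstDigits x n)) = cylinder x n := by
  ext y
  rw [mem_range_prepend, length_firstDigits, firstDigits_eq_iff]

theorem prepend_mem_cylinder (x φ : ℕ → Bool) (n : ℕ) :
    prepend (firstDigits x n) φ ∈ cylinder x n :=
  range_prepend_firstDigits x n ▸ mem_range_self φ

theorem range_prepend_eq_cylinder (w : List Bool) (ψ : ℕ → Bool) :
    range (prepend w) = cylinder (prepend w ψ) w.length := by
  rw [← range_prepend_firstDigits, firstDigits_prepend]

/-- If two words are prefixes of the same sequence, then the shorter is a prefix of the longer. -/
theorem exists_append_of_prepend_eq {u w : List Bool} {ψ φ : ℕ → Bool}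
    (h : prepend u ψ = prepend w φ) (hl : u.length ≤ w.length) : ∃ v, w = u ++ v := by
  refine ⟨w.drop u.length, ?_⟩
  conv_lhs => rw [← List.take_append_drop u.length w]
  congr 1
  apply List.ext_getElem (by simpa using hl)
  intro i h1 h2
  have := congrFun h i
  rw [prepend_of_lt h2, prepend_of_lt (by omega)] at this
  simpa using this.symm

/-! ### Cylinders and uniform continuity -/

section Topology

theorem nhds_hasBasis_cylinder (x : ℕ → Bool) :
    (𝓝 x).HasBasis (fun _ : ℕ => True) (cylinder x) := by
  refine ⟨fun t => ?_⟩
  rw [(isTopologicalBasis_cylinders (fun _ => Bool)).mem_nhds_iff]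
  constructor
  · rintro ⟨_, ⟨y, n, rfl⟩, hx, ht⟩
    exact ⟨n, trivial, (mem_cylinder_iff_eq.1 hx) ▸ ht⟩
  · rintro ⟨n, -, hn⟩
    exact ⟨_, ⟨x, n, rfl⟩, self_mem_cylinder x n, hn⟩

theorem continuous_iff_cylinder {h : (ℕ → Bool) → ℕ → Bool} :
    Continuous h ↔ ∀ x n, ∃ m, ∀ y ∈ cylinder x m, h y ∈ cylinder (h x) n := by
  rw [continuous_iff_continuousAt]
  refine forall_congr' fun x => ?_
  rw [ContinuousAt, (nhds_hasBasis_cylinder x).tendsto_iff (nhds_hasBasis_cylinder _)]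
  simp

theorem continuous_prepend (w : List Bool) : Continuous (prepend w) := by
  refine continuous_pi fun n => ?_
  by_cases h : n < w.length
  · simp only [prepend, h, dite_true]; exact continuous_const
  · simp only [prepend, h, dite_false]; exact continuous_apply _

theorem continuous_shift (n : ℕ) : Continuous (shift n) :=
  continuous_pi fun _ => continuous_apply _

theorem isOpen_range_prepend (w : List Bool) : IsOpen (range (prepend w)) := by
  rw [range_prepend_eq_cylinder w (fun _ => false)]; exact isOpen_cylinder _ _ _

theorem isClopen_range_prepend (w : List Bool) : IsClopen (range (prepend w)) :=
  ⟨(isCompact_range (continuous_prepend w)).isClosed, isOpen_range_prepend w⟩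

/-- A continuous self-map of the Cantor set is uniformly continuous. -/
theorem exists_uniform_modulus {h : (ℕ → Bool) → ℕ → Bool} (hc : Continuous h) (n : ℕ) :
    ∃ k, ∀ x, ∀ y ∈ cylinder x k, h y ∈ cylinder (h x) n := by
  choose m hm using fun x => continuous_iff_cylinder.1 hc x n
  obtain ⟨t, ht⟩ := isCompact_univ.elim_finite_subcover (fun x => cylinder x (m x))
    (fun x => isOpen_cylinder _ _ _) (fun x _ => mem_iUnion.2 ⟨x, self_mem_cylinder _ _⟩)
  refine ⟨t.sup m, fun x y hy => ?_⟩
  obtain ⟨z, hz, hxz⟩ := mem_iUnion₂.1 (ht (mem_univ x))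
  have hyz : y ∈ cylinder z (m z) := by
    have := cylinder_anti x (Finset.le_sup (f := m) hz) hy
    rwa [mem_cylinder_iff_eq.1 hxz] at this
  have h1 := hm z x hxz
  rw [mem_cylinder_iff_eq.1 h1]
  exact hm z y hyz

/-- The indicator of `E`, with constant sequences as values, is continuous; its uniform modulus at
one digit is the required `n`. -/
theorem IsClopen.exists_forall_mem_iff {E : Set (ℕ → Bool)} (hE : IsClopen E) :
    ∃ n, ∀ x, ∀ y ∈ cylinder x n, y ∈ E ↔ x ∈ E := by
  classical
  have hc : Continuous (E.piecewise (fun _ : ℕ → Bool => fun _ : ℕ => true)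
      (fun _ => fun _ => false)) :=
    Continuous.piecewise (by simp [hE.frontier_eq]) continuous_const continuous_const
  obtain ⟨n, hn⟩ := exists_uniform_modulus hc 1
  refine ⟨n, fun x y hy => ?_⟩
  have := hn x y hy 0 one_pos
  by_cases hx : x ∈ E <;> by_cases hy : y ∈ E <;> simp [hx, hy] at this ⊢

/-- A continuous bijection of the Cantor set, as a homeomorphism. -/
noncomputable def homeoOfBijective (h : (ℕ → Bool) → ℕ → Bool) (hc : Continuous h)
    (hb : Function.Bijective h) : (ℕ → Bool) ≃ₜ (ℕ → Bool) :=
  Continuous.homeoOfEquivCompactToT2 (f := Equiv.ofBijective h hb) hc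

end Topology

/-! ### Maps with finitely many local actions -/

/-- The map that acts by `h σ` on the tail of the sequences with first digit `σ`. -/
def branch (h : Bool → (ℕ → Bool) → ℕ → Bool) (ψ : ℕ → Bool) : ℕ → Bool := h (ψ 0) (shift 1 ψ)

@[simp] theorem branch_prepend (h : Bool → (ℕ → Bool) → ℕ → Bool) (σ : Bool) (ψ : ℕ → Bool) :
    branch h (prepend [σ] ψ) = h σ ψ := by simp [branch]

theorem continuous_branch {h : Bool → (ℕ → Bool) → ℕ → Bool} (hc : ∀ σ, Continuous (h σ)) :
    Continuous (branch h) := by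
  rw [continuous_iff_cylinder]
  intro x n
  obtain ⟨σ, φ, rfl⟩ := exists_eq_cons x
  obtain ⟨m, hm⟩ := continuous_iff_cylinder.1 (hc σ) φ n
  refine ⟨m + 1, fun y hy => ?_⟩
  obtain ⟨τ, ψ, rfl⟩ := exists_eq_cons y
  obtain rfl : τ = σ := by simpa using hy 0 (by omega)
  simp only [branch_prepend]
  exact hm ψ fun i hi => by simpa using hy (i + 1) (by omega)

/-- `h` has, up to prefixes of its values, only finitely many local actions `ψ ↦ h (w ψ)`. -/
def FiniteLocalActions (h : (ℕ → Bool) → ℕ → Bool) : Prop :=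
  ∃ F : Set ((ℕ → Bool) → ℕ → Bool), F.Finite ∧
    ∀ w, ∃ o, ∃ k ∈ F, ∀ ψ, h (prepend w ψ) = prepend o (k ψ)

namespace FiniteLocalActions

theorem _root_.finiteLocalActions_id : FiniteLocalActions id :=
  ⟨{id}, finite_singleton _, fun w => ⟨w, _, rfl, fun _ => rfl⟩⟩

theorem _root_.finiteLocalActions_prepend (u : List Bool) : FiniteLocalActions (prepend u) :=
  ⟨{id}, finite_singleton _, fun w => ⟨u ++ w, _, rfl, fun ψ => by simp [prepend_append]⟩⟩

theorem comp {g h : (ℕ → Bool) → ℕ → Bool} (hg : FiniteLocalActions g)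
    (hh : FiniteLocalActions h) : FiniteLocalActions (g ∘ h) := by
  obtain ⟨F, hF, hFg⟩ := hg
  obtain ⟨F', hF', hFh⟩ := hh
  refine ⟨image2 (· ∘ ·) F F', hF.image2 _ hF', fun w => ?_⟩
  obtain ⟨o, k, hk, e⟩ := hFh w
  obtain ⟨o', k', hk', e'⟩ := hFg o
  exact ⟨o', k' ∘ k, mem_image2_of_mem hk' hk, fun ψ => by simp [e, e']⟩

theorem of_cons {h : (ℕ → Bool) → ℕ → Bool}
    (hh : ∀ σ, FiniteLocalActions fun ψ => h (prepend [σ] ψ)) : FiniteLocalActions h := by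
  choose F hF hFh using hh
  refine ⟨insert h (⋃ σ, F σ), (finite_iUnion hF).insert _, fun w => ?_⟩
  match w with
  | [] => exact ⟨[], h, mem_insert _ _, fun ψ => by simp⟩
  | σ :: w =>
    obtain ⟨o, k, hk, e⟩ := hFh σ w
    exact ⟨o, k, mem_insert_of_mem _ (mem_iUnion.2 ⟨σ, hk⟩), fun ψ => by rw [prepend_cons, ← e]⟩

theorem _root_.finiteLocalActions_branch {h : Bool → (ℕ → Bool) → ℕ → Bool} (hh : ∀ σ, FiniteLocalActions (h σ)) :
    FiniteLocalActions (branch h) :=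
  of_cons fun σ => by simpa using hh σ

theorem _root_.finiteLocalActions_shift (n : ℕ) : FiniteLocalActions (shift n) := by
  induction n with
  | zero => convert finiteLocalActions_id; ext; simp
  | succ n ih =>
    rw [shift_succ]
    refine comp (of_cons fun σ => ?_) ih
    simpa using! finiteLocalActions_id

theorem of_length (n : ℕ) {h : (ℕ → Bool) → ℕ → Bool}
    (hh : ∀ w : List Bool, w.length = n → FiniteLocalActions fun ψ => h (prepend w ψ)) :
    FiniteLocalActions h := by
  induction n generalizing h with
  | zero => simpa using hh [] rfl
  | succ n ih =>
    refine of_cons fun σ => ih fun w hw => ?_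
    simpa [← prepend_cons] using hh (σ :: w) (by simp [hw])

/-- For `n` large, each cone of a word of length `n` lies inside `E` or misses it, so after `n`
digits only one of the two maps is in use. -/
theorem piecewise {E : Set (ℕ → Bool)} [∀ x, Decidable (x ∈ E)] (hE : IsClopen E)
    {g h : (ℕ → Bool) → ℕ → Bool} (hg : FiniteLocalActions g) (hh : FiniteLocalActions h) :
    FiniteLocalActions (E.piecewise g h) := by
  obtain ⟨n, hn⟩ := hE.exists_forall_mem_iff
  refine of_length n fun w hw => ?_
  have key : ∀ ψ, prepend w ψ ∈ E ↔ prepend w (fun _ => false) ∈ E := fun ψ =>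
    hn _ _ (hw ▸ range_prepend_eq_cylinder w _ ▸ mem_range_self ψ)
  by_cases hb : prepend w (fun _ => false) ∈ E
  · simpa [Set.piecewise, key, hb] using! hg.comp (finiteLocalActions_prepend w)
  · simpa [Set.piecewise, key, hb] using! hh.comp (finiteLocalActions_prepend w)

end FiniteLocalActions

/-! ### Normal form of a local action: removing the common prefix -/

section LocalAction

variable {h f : (ℕ → Bool) → ℕ → Bool}

/-- The length of the longest common prefix of the values of `h`. -/
noncomputable def commonLength (h : (ℕ → Bool) → ℕ → Bool) : ℕ :=
  sInf {n | ∃ ψ φ, h ψ n ≠ h φ n}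

/-- The longest common prefix of the values of `h`. -/
noncomputable def commonPrefix (h : (ℕ → Bool) → ℕ → Bool) : List Bool :=
  firstDigits (h fun _ => false) (commonLength h)

/-- The map `h` with the longest common prefix of its values removed. -/
noncomputable def strip (h : (ℕ → Bool) → ℕ → Bool) (ψ : ℕ → Bool) : ℕ → Bool :=
  shift (commonLength h) (h ψ)

theorem apply_eq_of_lt_commonLength {n : ℕ} (hn : n < commonLength h) (ψ φ : ℕ → Bool) :
    h ψ n = h φ n := by
  by_contra hne
  exact Nat.notMem_of_lt_sInf hn ⟨ψ, φ, hne⟩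

theorem exists_apply_ne (hi : Function.Injective h) : {n | ∃ ψ φ, h ψ n ≠ h φ n}.Nonempty := by
  have hne : h (fun _ => false) ≠ h (fun _ => true) := fun e => by
    simpa using congrFun (hi e) 0
  obtain ⟨n, hn⟩ := Function.ne_iff.1 hne
  exact ⟨n, _, _, hn⟩

theorem exists_apply_commonLength_ne (hi : Function.Injective h) :
    ∃ ψ φ, h ψ (commonLength h) ≠ h φ (commonLength h) :=
  Nat.sInf_mem (exists_apply_ne hi)

theorem le_commonLength (hi : Function.Injective h) {m : ℕ}
    (hm : ∀ ψ φ, ∀ i < m, h ψ i = h φ i) : m ≤ commonLength h := by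
  by_contra! hlt
  obtain ⟨ψ, φ, hne⟩ := exists_apply_commonLength_ne hi
  exact hne (hm ψ φ _ hlt)

@[simp] theorem length_commonPrefix : (commonPrefix h).length = commonLength h := by
  simp [commonPrefix]

theorem prepend_commonPrefix_strip (ψ : ℕ → Bool) : prepend (commonPrefix h) (strip h ψ) = h ψ := by
  rw [commonPrefix, strip, firstDigits_eq_iff.2, prepend_firstDigits_shift]
  exact fun i hi => apply_eq_of_lt_commonLength hi _ _

theorem strip_injective (hi : Function.Injective h) : Function.Injective (strip h) := fun ψ φ e =>
  hi (by rw [← prepend_commonPrefix_strip (h := h) ψ, e, prepend_commonPrefix_strip])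

theorem commonLength_prepend (hi : Function.Injective h) (o : List Bool) :
    commonLength (prepend o ∘ h) = o.length + commonLength h := by
  apply le_antisymm
  · by_contra! hlt
    obtain ⟨ψ, φ, hne⟩ := exists_apply_commonLength_ne hi
    have := apply_eq_of_lt_commonLength hlt ψ φ
    simp only [Function.comp_apply] at this
    rw [prepend_of_le (by omega), prepend_of_le (by omega)] at this
    simp_all
  · refine le_commonLength ((prepend_injective o).comp hi) fun ψ φ i hlt => ?_
    simp only [Function.comp_apply]
    rcases lt_or_ge i o.length with h1 | h1
    · rw [prepend_of_lt h1, prepend_of_lt h1]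
    · rw [prepend_of_le h1, prepend_of_le h1]
      exact apply_eq_of_lt_commonLength (by omega) _ _

theorem commonPrefix_prepend (hi : Function.Injective h) (o : List Bool) :
    commonPrefix (prepend o ∘ h) = o ++ commonPrefix h := by
  rw [← firstDigits_prepend (o ++ commonPrefix h) (strip h fun _ => false), prepend_append,
    prepend_commonPrefix_strip, commonPrefix, commonLength_prepend hi]
  simp

theorem strip_prepend (hi : Function.Injective h) (o : List Bool) :
    strip (prepend o ∘ h) = strip h := by
  ext ψ : 1
  rw [strip, strip, commonLength_prepend hi, ← shift_shift]
  simp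

theorem commonLength_strip (hi : Function.Injective h) : commonLength (strip h) = 0 := by
  have := commonLength_prepend (strip_injective hi) (commonPrefix h)
  rw [show prepend (commonPrefix h) ∘ strip h = h from funext prepend_commonPrefix_strip] at this
  simp_all

theorem commonLength_of_surjective (hs : Function.Surjective h) : commonLength h = 0 := by
  obtain ⟨ψ, hψ⟩ := hs fun _ => false
  obtain ⟨φ, hφ⟩ := hs fun _ => true
  exact Nat.sInf_eq_zero.2 (Or.inl ⟨ψ, φ, by simp [hψ, hφ]⟩)

theorem strip_of_commonLength (h0 : commonLength h = 0) : strip h = h := by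
  ext ψ : 1; simp [strip, h0]

/-- The local action of `f` at the word `w`. -/
noncomputable def localAction (f : (ℕ → Bool) → ℕ → Bool) (w : List Bool) :
    (ℕ → Bool) → ℕ → Bool :=
  strip (f ∘ prepend w)

theorem prepend_localAction (w : List Bool) (ψ : ℕ → Bool) :
    prepend (commonPrefix (f ∘ prepend w)) (localAction f w ψ) = f (prepend w ψ) :=
  prepend_commonPrefix_strip ψ

theorem localAction_injective (hi : Function.Injective f) (w : List Bool) :
    Function.Injective (localAction f w) :=
  strip_injective (hi.comp (prepend_injective w))

theorem comp_prepend_append (u w : List Bool) :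
    f ∘ prepend (u ++ w) = prepend (commonPrefix (f ∘ prepend u)) ∘ (localAction f u ∘ prepend w) :=
  funext fun ψ => by simp [prepend_localAction, prepend_append]

/-- The local action at `u ++ w` depends on `u` only through the local action at `u`; this allows
local actions to serve as states of a transducer. -/
theorem localAction_append (hi : Function.Injective f) (u w : List Bool) :
    localAction f (u ++ w) = strip (localAction f u ∘ prepend w) := by
  rw [localAction, comp_prepend_append,
    strip_prepend ((localAction_injective hi u).comp (prepend_injective w))]

/-- `strip` forgets prefixes, so each local action is the `strip` of a member of `F`. -/
theorem FiniteLocalActions.finite_range (hf : FiniteLocalActions f) (hi : Function.Injective f) :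
    (range (localAction f)).Finite := by
  obtain ⟨F, hF, hFf⟩ := hf
  refine (hF.image strip).subset ?_
  rintro _ ⟨w, rfl⟩
  obtain ⟨o, k, hk, e⟩ := hFf w
  have e' : f ∘ prepend w = prepend o ∘ k := funext e
  have hki : Function.Injective k :=
    Function.Injective.of_comp (f := prepend o) (e' ▸ hi.comp (prepend_injective w))
  exact ⟨k, hk, by rw [localAction, e', strip_prepend hki]⟩

end LocalAction

/-! ### Transducers and finite local actions -/

section Transducer

/-- The transducer whose states are the local actions of `f`. -/
noncomputable def localActionTransducer (f : (ℕ → Bool) → ℕ → Bool) (hi : Function.Injective f) :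
    BinaryTransducer (range (localAction f)) where
  init := ⟨localAction f [], mem_range_self _⟩
  t s σ := ⟨strip (s.1 ∘ prepend [σ]), by
    obtain ⟨w, hw⟩ := s.2
    exact ⟨w ++ [σ], by rw [localAction_append hi, hw]⟩⟩
  o s σ := commonPrefix (s.1 ∘ prepend [σ])

/-- The outputs telescope: each step emits the prefix that has just become common. The condition
`h0` matches the empty output on the empty word and is inherited by every later state. -/
theorem localActionTransducer_output {f : (ℕ → Bool) → ℕ → Bool} (hi : Function.Injective f)
    (w : List Bool) (s : range (localAction f)) (hs : Function.Injective s.1)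
    (h0 : commonLength s.1 = 0) :
    (localActionTransducer f hi).output s w = commonPrefix (s.1 ∘ prepend w) := by
  induction w generalizing s with
  | nil =>
    have : s.1 ∘ prepend [] = s.1 := funext fun ψ => by simp
    simp [BinaryTransducer.output, this, commonPrefix, h0, firstDigits]
  | cons σ w ih =>
    have hσ := hs.comp (prepend_injective [σ])
    rw [BinaryTransducer.output, ih]
    · have : s.1 ∘ prepend (σ :: w) =
          prepend (commonPrefix (s.1 ∘ prepend [σ])) ∘ (strip (s.1 ∘ prepend [σ]) ∘ prepend w) :=
        funext fun ψ => by
          simp only [Function.comp_apply, prepend_commonPrefix_strip, prepend_cons σ w]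
      rw [this, commonPrefix_prepend ((strip_injective hσ).comp (prepend_injective w))]
      rfl
    · exact strip_injective hσ
    · exact commonLength_strip hσ

theorem FiniteLocalActions.isRationalHomeo {f : (ℕ → Bool) ≃ₜ (ℕ → Bool)}
    (hf : FiniteLocalActions f) : IsRationalHomeo f := by
  have hi := f.injective
  refine ⟨range (localAction f), (hf.finite_range hi).to_subtype, localActionTransducer f hi,
    fun ψ => ?_⟩
  have hinit : localAction f [] = f := by
    have : f ∘ prepend [] = f := funext fun ψ => by simp
    rw [localAction, this, strip_of_commonLength (commonLength_of_surjective f.surjective)]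
  have hout (w : List Bool) : (localActionTransducer f hi).output (localActionTransducer f hi).init w
      = commonPrefix (f ∘ prepend w) := by
    rw [localActionTransducer_output hi w _ (localAction_injective hi [])]
    · simp only [localActionTransducer, hinit]
    · exact commonLength_strip (hi.comp (prepend_injective []))
  constructor
  · intro n
    rw [hout]
    have := prepend_localAction (f := f) (firstDigits ψ n) (shift n ψ)
    rw [prepend_firstDigits_shift] at this
    rw [← this, firstDigits_prepend]
  · intro m
    -- Continuity is what makes the output infinite: enough input digits force `m` common output
    -- digits.
    obtain ⟨n, hn⟩ := continuous_iff_cylinder.1 f.continuous ψ m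
    refine ⟨n, ?_⟩
    rw [hout, length_commonPrefix]
    refine le_commonLength (hi.comp (prepend_injective _)) fun φ φ' i hlt => ?_
    exact (hn _ (prepend_mem_cylinder ψ φ n) i hlt).trans
      (hn _ (prepend_mem_cylinder ψ φ' n) i hlt).symm

theorem firstDigits_prepend_add (w : List Bool) (ψ : ℕ → Bool) (n : ℕ) :
    firstDigits (prepend w ψ) (w.length + n) = w ++ firstDigits ψ n := by
  have := firstDigits_prepend (w ++ firstDigits ψ n) (shift n ψ)
  rwa [prepend_append, prepend_firstDigits_shift, List.length_append, length_firstDigits] at this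

namespace BinaryTransducer

variable {S : Type} {T : BinaryTransducer S} {s : S} {ψ x y : ℕ → Bool}

theorem OutputsOn.unique (hx : T.OutputsOn s ψ x) (hy : T.OutputsOn s ψ y) : x = y := by
  ext i
  obtain ⟨n, hn⟩ := hx.2 (i + 1)
  exact firstDigits_eq_iff.1 ((hx.1 n).symm.trans (hy.1 n)) i hn

theorem OutputsOn.step {σ : Bool} (hx : T.OutputsOn s (prepend [σ] ψ) x) :
    x = prepend (T.o s σ) (shift (T.o s σ).length x) ∧
      T.OutputsOn (T.t s σ) ψ (shift (T.o s σ).length x) := by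
  have hd (n : ℕ) : firstDigits (prepend [σ] ψ) (n + 1) = σ :: firstDigits ψ n := by
    simpa [add_comm] using firstDigits_prepend_add [σ] ψ n
  have h1 : x = prepend (T.o s σ) (shift (T.o s σ).length x) := by
    have := hx.1 1
    rw [hd 0] at this
    simp only [output, firstDigits, List.range_zero, List.map_nil, List.append_nil] at this
    obtain ⟨φ, rfl⟩ := mem_range_prepend.2 this.symm
    rw [shift_prepend]
  refine ⟨h1, fun n => ?_, fun m => ?_⟩
  · have := hx.1 (n + 1)
    rw [hd, output, List.length_append] at this
    conv_rhs at this => rw [h1]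
    rw [firstDigits_prepend_add] at this
    exact List.append_cancel_left this
  · obtain ⟨n, hn⟩ := hx.2 ((T.o s σ).length + m)
    cases n with
    | zero => exact ⟨0, by simp [firstDigits, output] at hn; omega⟩
    | succ n => exact ⟨n, by rw [hd, output, List.length_append] at hn; omega⟩

/-- The map computed by `T` from the state `s`, where it is defined. -/
noncomputable def eval (T : BinaryTransducer S) (s : S) (ψ : ℕ → Bool) : ℕ → Bool :=
  Classical.epsilon (T.OutputsOn s ψ)

/-- Here `s'` is the state reached from `s` by `w`. The arbitrary values of `eval` are harmless,
since the computation from `s'` has an infinite output on every input. -/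
theorem exists_eval {f : (ℕ → Bool) → ℕ → Bool} (hf : ∀ ψ, T.OutputsOn s ψ (f ψ))
    (w : List Bool) : ∃ o s', ∀ ψ, f (prepend w ψ) = prepend o (T.eval s' ψ) := by
  induction w generalizing s f with
  | nil =>
    exact ⟨[], s, fun ψ => by
      simpa using (hf ψ).unique (y := T.eval s ψ) (Classical.epsilon_spec ⟨_, hf ψ⟩)⟩
  | cons σ w ih =>
    obtain ⟨o, s', h⟩ := ih fun ψ => (hf (prepend [σ] ψ)).step.2
    refine ⟨T.o s σ ++ o, s', fun ψ => ?_⟩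
    rw [prepend_cons, prepend_append, ← h]
    exact (hf _).step.1

end BinaryTransducer

theorem isRationalHomeo_iff {f : (ℕ → Bool) ≃ₜ (ℕ → Bool)} :
    IsRationalHomeo f ↔ FiniteLocalActions f := by
  refine ⟨?_, FiniteLocalActions.isRationalHomeo⟩
  rintro ⟨S, _, T, hT⟩
  refine ⟨range T.eval, finite_range _, fun w => ?_⟩
  obtain ⟨o, s, h⟩ := BinaryTransducer.exists_eval hT w
  exact ⟨o, _, mem_range_self s, h⟩

end Transducer

/-! ### Inverses and the rational group -/

section Inverse

variable {f : (ℕ → Bool) ≃ₜ (ℕ → Bool)}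

/-- Uniform continuity of `f⁻¹`: if the values at `φ` and `φ'` share a very long prefix, then `u φ`
and `u φ'` agree at position `u.length`. -/
theorem exists_length_le_of_localAction_mem (u : List Bool) :
    ∃ K, ∀ v φ φ', φ 0 ≠ φ' 0 → localAction f u φ ∈ range (prepend v) →
      localAction f u φ' ∈ range (prepend v) → v.length ≤ K := by
  obtain ⟨k, hk⟩ := exists_uniform_modulus f.symm.continuous (u.length + 1)
  refine ⟨k, fun v φ φ' hne h1 h2 => ?_⟩
  by_contra! hlt
  obtain ⟨α, hα⟩ := h1
  obtain ⟨β, hβ⟩ := h2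
  refine hne ?_
  have := hk (f (prepend u φ)) (f (prepend u φ')) ?_ u.length (by omega)
  · simpa [prepend] using this.symm
  · rw [← prepend_localAction (f := f), ← prepend_localAction (f := f), ← hα, ← hβ, ← prepend_append,
      ← prepend_append]
    intro i hi
    rw [prepend_of_lt (by simp; omega), prepend_of_lt (by simp; omega)]

/-- With `u` the common prefix of the sequences `f⁻¹ (v ψ)`, the common output of `f` on the cone of
`u` is a prefix of `v`, because `ψ` is arbitrary. The rest of `v` is `v'`. -/
theorem exists_localAction_symm (v : List Bool) : ∃ u v',
    ∀ ψ, localAction f u (localAction f.symm v ψ) = prepend v' ψ := by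
  set u := commonPrefix (f.symm ∘ prepend v)
  have key (ψ : ℕ → Bool) : prepend (commonPrefix (f ∘ prepend u))
      (localAction f u (localAction f.symm v ψ)) = prepend v ψ := by
    rw [prepend_localAction, prepend_localAction]; simp
  have hle : (commonPrefix (f ∘ prepend u)).length ≤ v.length := by
    by_contra! hlt
    have h0 := congrFun (key fun _ => false) v.length
    have h1 := congrFun (key fun _ => true) v.length
    rw [prepend_of_lt hlt] at h0 h1
    rw [h0] at h1
    simp [prepend] at h1
  obtain ⟨v', hv'⟩ := exists_append_of_prepend_eq (key fun _ => false) hle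
  refine ⟨u, v', fun ψ => prepend_injective _ ((key ψ).trans ?_)⟩
  rw [← prepend_append, ← hv']

theorem FiniteLocalActions.symm (hf : FiniteLocalActions f) : FiniteLocalActions f.symm := by
  have hfin := hf.finite_range f.injective
  have hK : ∀ h ∈ range (localAction f), ∃ K, ∀ v φ φ', φ 0 ≠ φ' 0 → h φ ∈ range (prepend v) →
      h φ' ∈ range (prepend v) → v.length ≤ K := by
    rintro _ ⟨u, rfl⟩
    exact exists_length_le_of_localAction_mem u
  -- The bound is attached to the local action as a map, not to the word `u`, so finitely many
  -- bounds suffice.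
  choose! K hK using hK
  obtain ⟨M, hM⟩ := (hfin.image K).bddAbove
  refine ⟨image2 (fun h v ψ => Function.invFun h (prepend v ψ)) (range (localAction f))
    {v | v.length ≤ M}, hfin.image2 _ (List.finite_length_le Bool M), fun v => ?_⟩
  obtain ⟨u, v', huv⟩ := exists_localAction_symm (f := f) v
  refine ⟨commonPrefix (f.symm ∘ prepend v), localAction f.symm v,
    ⟨localAction f u, mem_range_self u, v', ?_, ?_⟩, fun ψ => (prepend_localAction v ψ).symm⟩
  · refine le_trans ?_ (hM (mem_image_of_mem K (mem_range_self u)))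
    have hi := f.symm.injective.comp (prepend_injective v)
    -- A local action of `f⁻¹` has no common prefix, so two of its values differ in the first digit;
    -- this bounds `v'`.
    obtain ⟨ψ, φ, hne⟩ := exists_apply_commonLength_ne (strip_injective hi)
    rw [commonLength_strip hi] at hne
    exact hK _ (mem_range_self u) v' _ _ hne ⟨ψ, (huv ψ).symm⟩ ⟨φ, (huv φ).symm⟩
  · ext ψ : 1
    simp only [← huv]
    exact Function.leftInverse_invFun (localAction_injective f.injective u) _

end Inverse

/-- The asynchronous rational group. -/
def rationalGroup : Subgroup ((ℕ → Bool) ≃ₜ (ℕ → Bool)) where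
  carrier := {f | FiniteLocalActions f}
  mul_mem' hf hg := hf.comp hg
  one_mem' := finiteLocalActions_id
  inv_mem' hf := hf.symm

/-! ### Ladder maps -/

section Ladder

variable {k : ℕ} {e : (ℕ → Bool) → ℕ → Bool}

open scoped Classical in
/-- The map `1ⁿ0ψ ↦ 1ᵏⁿe(ψ)`, fixing the constant sequence `1`. -/
noncomputable def ladder (k : ℕ) (e : (ℕ → Bool) → ℕ → Bool) (ψ : ℕ → Bool) : ℕ → Bool :=
  if h : ∃ n, ψ n = false then
    prepend (List.replicate (k * Nat.find h) true) (e (shift (Nat.find h + 1) ψ))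
  else fun _ => true

@[simp] theorem ladder_false (ψ : ℕ → Bool) : ladder k e (prepend [false] ψ) = e ψ := by
  have h : ∃ n, prepend [false] ψ n = false := ⟨0, rfl⟩
  have h0 : Nat.find h = 0 := by simp
  rw [ladder, dif_pos h, h0]
  simp

theorem prepend_replicate_true (k : ℕ) :
    prepend (List.replicate k true) (fun _ => true) = fun _ => true := by
  ext n; simp [prepend]

theorem ladder_const : ladder k e (fun _ => true) = fun _ => true := by
  rw [ladder, dif_neg (by simp)]

@[simp] theorem ladder_true (ψ : ℕ → Bool) :
    ladder k e (prepend [true] ψ) = prepend (List.replicate k true) (ladder k e ψ) := by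
  by_cases h : ∃ n, ψ n = false
  · have h' : ∃ n, prepend [true] ψ n = false := by
      obtain ⟨n, hn⟩ := h
      exact ⟨n + 1, by simpa using hn⟩
    have hs : Nat.find h' = Nat.find h + 1 := by
      rw [Nat.find_eq_iff]
      refine ⟨by simpa using Nat.find_spec h, fun n hn => ?_⟩
      cases n with
      | zero => simp
      | succ n => simpa using Nat.find_min h (m := n) (by omega)
    rw [ladder, dif_pos h', ladder, dif_pos h, hs, ← prepend_append, List.replicate_append_replicate,
      add_comm (Nat.find h + 1) 1, ← shift_shift, shift_one_prepend, mul_add, mul_one, add_comm k]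
  · have h' : ¬ ∃ n, prepend [true] ψ n = false := by
      push Not at h ⊢
      intro n
      cases n with
      | zero => simp
      | succ n => simpa using h n
    rw [ladder, dif_neg h', ladder, dif_neg h, prepend_replicate_true]

/-- Reading `1` emits `1ᵏ` and stays in the state `ladder k e`; the first `0` passes to `e`. -/
theorem finiteLocalActions_ladder (he : FiniteLocalActions e) : FiniteLocalActions (ladder k e) := by
  obtain ⟨F, hF, hFe⟩ := he
  refine ⟨insert (ladder k e) F, hF.insert _, fun w => ?_⟩
  induction w with
  | nil => exact ⟨[], _, mem_insert _ _, fun ψ => by simp⟩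
  | cons σ w ih =>
    cases σ with
    | false =>
      obtain ⟨o, h, hh, ho⟩ := hFe w
      exact ⟨o, h, mem_insert_of_mem _ hh, fun ψ => by rw [prepend_cons, ladder_false, ho]⟩
    | true =>
      obtain ⟨o, h, hh, ho⟩ := ih
      exact ⟨List.replicate k true ++ o, h, hh, fun ψ => by
        rw [prepend_cons, ladder_true, ho, prepend_append]⟩

/-- A leading `1` emits `k > 0` digits, so the number of digits still to be controlled drops. -/
theorem continuous_ladder (hk : 0 < k) (he : Continuous e) : Continuous (ladder k e) := by
  rw [continuous_iff_cylinder]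
  intro x n
  induction n using Nat.strong_induction_on generalizing x with
  | _ n ih =>
    rcases n.eq_zero_or_pos with rfl | hn
    · exact ⟨0, by simp⟩
    obtain ⟨σ, φ, rfl⟩ := exists_eq_cons x
    have hcons {m : ℕ} {y : ℕ → Bool} (hy : y ∈ cylinder (prepend [σ] φ) (m + 1)) :
        ∃ ψ ∈ cylinder φ m, y = prepend [σ] ψ := by
      obtain ⟨τ, ψ, rfl⟩ := exists_eq_cons y
      obtain rfl : τ = σ := by simpa using hy 0 (by omega)
      exact ⟨ψ, fun i hi => by simpa using hy (i + 1) (by omega), rfl⟩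
    cases σ with
    | false =>
      obtain ⟨m, hm⟩ := continuous_iff_cylinder.1 he φ n
      refine ⟨m + 1, fun y hy => ?_⟩
      obtain ⟨ψ, hψ, rfl⟩ := hcons hy
      simpa only [ladder_false] using hm ψ hψ
    | true =>
      obtain ⟨m, hm⟩ := ih (n - k) (by omega) φ
      refine ⟨m + 1, fun y hy => ?_⟩
      obtain ⟨ψ, hψ, rfl⟩ := hcons hy
      simp only [ladder_true]
      intro i hi
      by_cases h : i < k
      · simp [prepend, h]
      · simpa [prepend, h] using hm ψ hψ (i - k) (by omega)

theorem ladder_injective (hi : Function.Injective e)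
    (hr : range e = (range (prepend (List.replicate k true)))ᶜ) :
    Function.Injective (ladder k e) := by
  have hne (ψ φ : ℕ → Bool) : e ψ ≠ prepend (List.replicate k true) φ := fun h =>
    (hr ▸ mem_range_self ψ : e ψ ∈ (range (prepend (List.replicate k true)))ᶜ) ⟨φ, h.symm⟩
  intro x y hxy
  ext n
  induction n generalizing x y with
  | zero =>
    obtain ⟨σ, φ, rfl⟩ := exists_eq_cons x
    obtain ⟨τ, ψ, rfl⟩ := exists_eq_cons y
    cases σ <;> cases τ <;> simp only [ladder_true, ladder_false, prepend_singleton_zero] at hxy ⊢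
    · exact absurd hxy (hne _ _)
    · exact absurd hxy.symm (hne _ _)
  | succ n ih =>
    obtain ⟨σ, φ, rfl⟩ := exists_eq_cons x
    obtain ⟨τ, ψ, rfl⟩ := exists_eq_cons y
    cases σ <;> cases τ <;> simp only [ladder_true, ladder_false, prepend_singleton_succ] at hxy ⊢
    · rw [hi hxy]
    · exact absurd hxy (hne _ _)
    · exact absurd hxy.symm (hne _ _)
    · exact ih (prepend_injective _ hxy)

/-- The sets `1ᵏⁿ (range e)` partition the complement of the constant sequence `1`. The induction
strips `1ᵏ` and follows the position of a digit `0`. -/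
theorem ladder_surjective (hk : 0 < k)
    (hr : range e = (range (prepend (List.replicate k true)))ᶜ) :
    Function.Surjective (ladder k e) := by
  intro y
  by_cases hy : ∃ n, y n = false
  · obtain ⟨n, hn⟩ := hy
    induction n using Nat.strong_induction_on generalizing y with
    | _ n ih =>
      by_cases h : y ∈ range (prepend (List.replicate k true))
      · obtain ⟨z, rfl⟩ := h
        have hkn : k ≤ n := by
          by_contra! hlt
          simp [prepend, hlt] at hn
        rw [prepend_of_le (by simpa using hkn), List.length_replicate] at hn
        obtain ⟨x, rfl⟩ := ih (n - k) (by omega) z hn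
        exact ⟨prepend [true] x, ladder_true x⟩
      · obtain ⟨x, rfl⟩ : y ∈ range e := hr ▸ h
        exact ⟨prepend [false] x, ladder_false x⟩
  · have : y = fun _ => true := by
      ext n
      simpa using fun h => hy ⟨n, h⟩
    exact ⟨_, this ▸ ladder_const⟩

/-- `ladder k e` as a homeomorphism. -/
noncomputable def ladderHomeo (hk : 0 < k) (he : Continuous e) (hi : Function.Injective e)
    (hr : range e = (range (prepend (List.replicate k true)))ᶜ) : (ℕ → Bool) ≃ₜ (ℕ → Bool) :=
  homeoOfBijective (ladder k e) (continuous_ladder hk he)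
    ⟨ladder_injective hi hr, ladder_surjective hk hr⟩

end Ladder

/-! ### Homeomorphisms supported in a cone -/

section ConePerm

open scoped Classical

/-- The map that acts by `f` on the sequences with prefix `a` and fixes all others. -/
noncomputable def conePermFun (a : List Bool) (f : (ℕ → Bool) → ℕ → Bool) :
    (ℕ → Bool) → ℕ → Bool :=
  (range (prepend a)).piecewise (prepend a ∘ f ∘ shift a.length) id

@[simp] theorem conePermFun_prepend (a : List Bool) (f : (ℕ → Bool) → ℕ → Bool) (ψ : ℕ → Bool) :
    conePermFun a f (prepend a ψ) = prepend a (f ψ) := by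
  simp [conePermFun]

theorem conePermFun_of_notMem {a : List Bool} {x : ℕ → Bool} (hx : x ∉ range (prepend a))
    (f : (ℕ → Bool) → ℕ → Bool) : conePermFun a f x = x := by
  rw [conePermFun, Set.piecewise_eq_of_notMem _ _ _ hx, id]

theorem conePermFun_comp (a : List Bool) (f g : (ℕ → Bool) → ℕ → Bool) (x : ℕ → Bool) :
    conePermFun a f (conePermFun a g x) = conePermFun a (f ∘ g) x := by
  by_cases hx : x ∈ range (prepend a)
  · obtain ⟨ψ, rfl⟩ := hx
    simp
  · simp [conePermFun_of_notMem hx]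

theorem conePermFun_id (a : List Bool) (x : ℕ → Bool) : conePermFun a id x = x := by
  by_cases hx : x ∈ range (prepend a)
  · obtain ⟨ψ, rfl⟩ := hx
    simp
  · simp [conePermFun_of_notMem hx]

theorem continuous_conePermFun (a : List Bool) {f : (ℕ → Bool) → ℕ → Bool} (hf : Continuous f) :
    Continuous (conePermFun a f) :=
  Continuous.piecewise (by simp [(isClopen_range_prepend a).frontier_eq])
    ((continuous_prepend a).comp (hf.comp (continuous_shift _))) continuous_id

/-- The homeomorphism that acts by `f` on the sequences with prefix `a` and fixes all others. -/
noncomputable def conePerm (a : List Bool) :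
    ((ℕ → Bool) ≃ₜ (ℕ → Bool)) →* ((ℕ → Bool) ≃ₜ (ℕ → Bool)) :=
  MonoidHom.mk'
    (fun f =>
      { toFun := conePermFun a f
        invFun := conePermFun a f.symm
        left_inv := fun x => by
          rw [conePermFun_comp, f.symm_comp_self, conePermFun_id]
        right_inv := fun x => by
          rw [conePermFun_comp, f.self_comp_symm, conePermFun_id]
        continuous_toFun := continuous_conePermFun a f.continuous
        continuous_invFun := continuous_conePermFun a f.symm.continuous })
    fun f g => Homeomorph.ext fun x => (conePermFun_comp a f g x).symm

variable {a b : List Bool} {f g : (ℕ → Bool) ≃ₜ (ℕ → Bool)} {x : ℕ → Bool}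

@[simp] theorem conePerm_prepend (a : List Bool) (f : (ℕ → Bool) ≃ₜ (ℕ → Bool)) (ψ : ℕ → Bool) :
    conePerm a f (prepend a ψ) = prepend a (f ψ) := conePermFun_prepend a f ψ

theorem conePerm_of_notMem (hx : x ∉ range (prepend a)) (f : (ℕ → Bool) ≃ₜ (ℕ → Bool)) :
    conePerm a f x = x := conePermFun_of_notMem hx f

theorem conePerm_mem (a : List Bool) (hf : f ∈ rationalGroup) : conePerm a f ∈ rationalGroup :=
  FiniteLocalActions.piecewise (isClopen_range_prepend a)
    ((finiteLocalActions_prepend a).comp (hf.comp (finiteLocalActions_shift _)))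
    finiteLocalActions_id

theorem conePerm_conePerm (a b : List Bool) (f : (ℕ → Bool) ≃ₜ (ℕ → Bool)) :
    conePerm a (conePerm b f) = conePerm (a ++ b) f := by
  ext x : 1
  by_cases hx : x ∈ range (prepend a)
  · obtain ⟨ψ, rfl⟩ := hx
    by_cases hψ : ψ ∈ range (prepend b)
    · obtain ⟨φ, rfl⟩ := hψ
      rw [conePerm_prepend, conePerm_prepend, ← prepend_append, ← prepend_append, conePerm_prepend]
    · rw [conePerm_prepend, conePerm_of_notMem hψ, conePerm_of_notMem]
      rintro ⟨φ, hφ⟩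
      rw [prepend_append] at hφ
      exact hψ ⟨φ, prepend_injective a hφ⟩
  · rw [conePerm_of_notMem hx, conePerm_of_notMem]
    rintro ⟨φ, rfl⟩
    exact hx ⟨_, (prepend_append a b φ).symm⟩

theorem conePerm_conj (hg : ∀ ψ, g (prepend a ψ) = prepend b ψ) :
    g * conePerm a f * g⁻¹ = conePerm b f := by
  rw [mul_inv_eq_iff_eq_mul]
  ext x : 1
  simp only [Homeomorph.mul_apply]
  by_cases hx : x ∈ range (prepend a)
  · obtain ⟨ψ, rfl⟩ := hx
    simp [hg]
  · rw [conePerm_of_notMem hx, conePerm_of_notMem]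
    rintro ⟨ψ, hψ⟩
    rw [← hg] at hψ
    exact hx ⟨ψ, g.injective hψ⟩

end ConePerm

/-! ### Moving any proper cone to any other -/

section Transit

/-- Some rational homeomorphism replaces the prefix `a` by the prefix `b`. -/
def Transit (a b : List Bool) : Prop :=
  ∃ g ∈ rationalGroup, ∀ ψ, g (prepend a ψ) = prepend b ψ

namespace Transit

variable {a b c : List Bool}

theorem symm (h : Transit a b) : Transit b a := by
  obtain ⟨g, hg, e⟩ := h
  exact ⟨g⁻¹, inv_mem hg, fun ψ => by simp [← e]⟩

theorem trans (h : Transit a b) (h' : Transit b c) : Transit a c := by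
  obtain ⟨g, hg, e⟩ := h
  obtain ⟨g', hg', e'⟩ := h'
  exact ⟨g' * g, mul_mem hg' hg, fun ψ => by simp [e, e']⟩

theorem append (h : Transit a b) (c : List Bool) : Transit (a ++ c) (b ++ c) := by
  obtain ⟨g, hg, e⟩ := h
  exact ⟨g, hg, fun ψ => by simp [prepend_append, e]⟩

end Transit

/-- The homeomorphism that changes the first digit. -/
def flipFirst : (ℕ → Bool) ≃ₜ (ℕ → Bool) where
  toFun := branch fun σ => prepend [!σ]
  invFun := branch fun σ => prepend [!σ]
  left_inv x := by obtain ⟨σ, φ, rfl⟩ := exists_eq_cons x; simp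
  right_inv x := by obtain ⟨σ, φ, rfl⟩ := exists_eq_cons x; simp
  continuous_toFun := continuous_branch fun _ => continuous_prepend _
  continuous_invFun := continuous_branch fun _ => continuous_prepend _

theorem flipFirst_mem : flipFirst ∈ rationalGroup :=
  finiteLocalActions_branch (h := fun σ => prepend [!σ]) fun _ => finiteLocalActions_prepend _

theorem flipFirst_prepend (σ : Bool) (ψ : ℕ → Bool) :
    flipFirst (prepend [σ] ψ) = prepend [!σ] ψ :=
  branch_prepend (fun σ => prepend [!σ]) σ ψ

theorem flipFirst_ne_one : flipFirst ≠ 1 := fun h => by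
  have := congrFun (congrArg DFunLike.coe h) (prepend [false] fun _ => false)
  rw [flipFirst_prepend] at this
  simpa using congrFun this 0

/-- The map `00ψ ↦ 0ψ`, `01ψ ↦ 10ψ`, `1ψ ↦ 11ψ`. -/
def rotateConesFun : (ℕ → Bool) → ℕ → Bool :=
  branch fun σ => match σ with
    | false => branch fun τ => match τ with
      | false => prepend [false]
      | true => prepend [true] ∘ prepend [false]
    | true => prepend [true] ∘ prepend [true]

/-- The map `0ψ ↦ 00ψ`, `10ψ ↦ 01ψ`, `11ψ ↦ 1ψ`. -/
def rotateConesInv : (ℕ → Bool) → ℕ → Bool :=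
  branch fun σ => match σ with
    | false => prepend [false] ∘ prepend [false]
    | true => branch fun τ => match τ with
      | false => prepend [false] ∘ prepend [true]
      | true => prepend [true]

/-- The homeomorphism `00ψ ↦ 0ψ`, `01ψ ↦ 10ψ`, `1ψ ↦ 11ψ`. -/
def rotateCones : (ℕ → Bool) ≃ₜ (ℕ → Bool) where
  toFun := rotateConesFun
  invFun := rotateConesInv
  left_inv x := by
    obtain ⟨σ, φ, rfl⟩ := exists_eq_cons x
    obtain ⟨τ, ψ, rfl⟩ := exists_eq_cons φ
    cases σ <;> cases τ <;> simp [rotateConesFun, rotateConesInv]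
  right_inv x := by
    obtain ⟨σ, φ, rfl⟩ := exists_eq_cons x
    obtain ⟨τ, ψ, rfl⟩ := exists_eq_cons φ
    cases σ <;> cases τ <;> simp [rotateConesFun, rotateConesInv]
  continuous_toFun := continuous_branch fun σ => match σ with
    | false => continuous_branch fun τ => match τ with
      | false => continuous_prepend _
      | true => (continuous_prepend _).comp (continuous_prepend _)
    | true => (continuous_prepend _).comp (continuous_prepend _)
  continuous_invFun := continuous_branch fun σ => match σ with
    | false => (continuous_prepend _).comp (continuous_prepend _)
    | true => continuous_branch fun τ => match τ with
      | false => (continuous_prepend _).comp (continuous_prepend _)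
      | true => continuous_prepend _

theorem finiteLocalActions_rotateConesFun : FiniteLocalActions rotateConesFun :=
  finiteLocalActions_branch fun σ => match σ with
    | false => finiteLocalActions_branch fun τ => match τ with
      | false => finiteLocalActions_prepend _
      | true => (finiteLocalActions_prepend _).comp (finiteLocalActions_prepend _)
    | true => (finiteLocalActions_prepend _).comp (finiteLocalActions_prepend _)

theorem rotateCones_mem : rotateCones ∈ rationalGroup := finiteLocalActions_rotateConesFun

theorem rotateCones_apply (x : ℕ → Bool) : rotateCones x = rotateConesFun x := rfl

theorem rotateCones_true (ψ : ℕ → Bool) :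
    rotateCones (prepend [true] ψ) = prepend [true, true] ψ := by
  rw [prepend_cons true [true]]
  simp [rotateCones_apply, rotateConesFun]

theorem rotateCones_false_false (ψ : ℕ → Bool) :
    rotateCones (prepend [false, false] ψ) = prepend [false] ψ := by
  rw [prepend_cons]
  simp [rotateCones_apply, rotateConesFun]

theorem transit_singleton (σ τ : Bool) : Transit [σ] [τ] := by
  by_cases h : σ = τ
  · exact ⟨1, one_mem _, fun ψ => by simp [h]⟩
  · exact ⟨flipFirst, flipFirst_mem, fun ψ => by
      rw [flipFirst_prepend, Bool.eq_not_iff.2 h, Bool.not_not]⟩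

/-- Words are shortened from the left end: once the initial part is moved to `1`, only `10` and `11`
remain, and `rotateCones` gives `00 → 0` and `1 → 11`. -/
theorem transit_true {a : List Bool} (ha : a ≠ []) : Transit a [true] := by
  induction a using List.reverseRecOn with
  | nil => exact absurd rfl ha
  | append_singleton a σ ih =>
    rcases eq_or_ne a [] with rfl | h
    · exact transit_singleton _ _
    · refine ((ih h).append [σ]).trans ?_
      cases σ
      · exact ((transit_singleton true false).append [false]).trans
          (Transit.trans ⟨rotateCones, rotateCones_mem, rotateCones_false_false⟩ (transit_singleton _ _))
      · exact Transit.symm ⟨rotateCones, rotateCones_mem, rotateCones_true⟩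

theorem transit {a b : List Bool} (ha : a ≠ []) (hb : b ≠ []) : Transit a b :=
  (transit_true ha).trans (transit_true hb).symm

end Transit

/-! ### The infinite swindle -/

section Swindle

variable {f : (ℕ → Bool) ≃ₜ (ℕ → Bool)}

/-- Infinitely many disjoint copies of `f` make it a commutator. -/
theorem exists_commutator_eq_conePerm (hf : f ∈ rationalGroup) :
    ∃ F ∈ rationalGroup, ∃ g ∈ rationalGroup, ⁅F, g⁆ = conePerm [true, false] f := by
  have hr : range (prepend [false] ∘ f) = (range (prepend (List.replicate 1 true)))ᶜ := by
    ext x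
    obtain ⟨σ, φ, rfl⟩ := exists_eq_cons x
    rw [range_comp, f.surjective.range_eq, image_univ, mem_compl_iff, mem_range_prepend,
      mem_range_prepend]
    cases σ <;> simp [firstDigits]
  -- `Φ` sends `1ⁿ0ψ` to `1ⁿ0f(ψ)`: a copy of `f` on each cone `1ⁿ0`.
  set Φ := ladderHomeo one_pos ((continuous_prepend [false]).comp f.continuous)
    ((prepend_injective [false]).comp f.injective) hr
  have hΦ : Φ ∈ rationalGroup := finiteLocalActions_ladder ((finiteLocalActions_prepend _).comp hf)
  refine ⟨conePerm [true] Φ, conePerm_mem _ hΦ, rotateCones, rotateCones_mem, ?_⟩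
  -- The inverse of `Φ`, moved one rung down, cancels every copy of `f` except the one on the cone
  -- `0`.
  have h1 : Φ * conePerm [true] Φ⁻¹ = conePerm [false] f := by
    ext x : 1
    obtain ⟨σ, φ, rfl⟩ := exists_eq_cons x
    have hn {σ τ : Bool} (h : τ ≠ σ) : prepend [σ] φ ∉ range (prepend [τ]) := by
      rintro ⟨ψ, e⟩
      exact h (congrFun e 0)
    rw [Homeomorph.mul_apply]
    cases σ
    · rw [conePerm_of_notMem (hn (by simp)), conePerm_prepend]
      exact ladder_false φ
    · rw [conePerm_prepend, conePerm_of_notMem (hn (by simp))]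
      exact (ladder_true _).trans (congrArg (prepend [true]) (Φ.apply_symm_apply φ))
  calc ⁅conePerm [true] Φ, rotateCones⁆
      = conePerm [true] Φ * (rotateCones * conePerm [true] Φ⁻¹ * rotateCones⁻¹) := by
        rw [commutatorElement_def, map_inv]; group
    _ = conePerm [true] (Φ * conePerm [true] Φ⁻¹) := by
        rw [conePerm_conj rotateCones_true, map_mul, conePerm_conePerm]; rfl
    _ = conePerm [true, false] f := by rw [h1, conePerm_conePerm]; rfl

end Swindle

/-! ### Exchanging a clopen set with a disjoint image -/

section Exchange

open scoped Classical

variable {E : Set (ℕ → Bool)} {h : (ℕ → Bool) ≃ₜ (ℕ → Bool)}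

/-- The map that exchanges `E` with its image under `h`, and fixes the rest. -/
noncomputable def exchangeFun (E : Set (ℕ → Bool)) (h : (ℕ → Bool) ≃ₜ (ℕ → Bool)) :
    (ℕ → Bool) → ℕ → Bool :=
  E.piecewise h ((h.symm ⁻¹' E).piecewise h.symm id)

theorem exchangeFun_involutive (hd : Disjoint E (h '' E)) :
    Function.Involutive (exchangeFun E h) := by
  intro x
  have hd' : ∀ y ∈ E, h y ∉ E := fun y hy hh => disjoint_left.1 hd hh (mem_image_of_mem h hy)
  by_cases h1 : x ∈ E
  · simp [exchangeFun, h1, hd' x h1, Set.piecewise]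
  · by_cases h2 : h.symm x ∈ E <;> simp [exchangeFun, h1, h2, Set.piecewise]

theorem continuous_exchangeFun (hE : IsClopen E) : Continuous (exchangeFun E h) :=
  Continuous.piecewise (by simp [hE.frontier_eq]) h.continuous
    (Continuous.piecewise (by simp [(hE.preimage h.symm.continuous).frontier_eq])
      h.symm.continuous continuous_id)

/-- The involution that exchanges `E` with its image under `h`, and fixes the rest. -/
noncomputable def exchange (hE : IsClopen E) (hd : Disjoint E (h '' E)) :
    (ℕ → Bool) ≃ₜ (ℕ → Bool) where
  toFun := exchangeFun E h
  invFun := exchangeFun E h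
  left_inv := exchangeFun_involutive hd
  right_inv := exchangeFun_involutive hd
  continuous_toFun := continuous_exchangeFun hE
  continuous_invFun := continuous_exchangeFun hE

theorem exchange_mem (hE : IsClopen E) (hd : Disjoint E (h '' E)) (hh : h ∈ rationalGroup) :
    exchange hE hd ∈ rationalGroup :=
  FiniteLocalActions.piecewise hE hh
    (FiniteLocalActions.piecewise (hE.preimage h.symm.continuous) hh.symm finiteLocalActions_id)

theorem exchange_apply_of_mem (hE : IsClopen E) (hd : Disjoint E (h '' E)) {x : ℕ → Bool}
    (hx : x ∈ E) : exchange hE hd x = h x :=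
  Set.piecewise_eq_of_mem _ _ _ hx

theorem exchange_apply_of_notMem (hE : IsClopen E) (hd : Disjoint E (h '' E)) {x : ℕ → Bool}
    (hx : x ∉ E) (hx' : x ∉ h '' E) : exchange hE hd x = x := by
  have : x ∉ h.symm ⁻¹' E := fun hm => hx' ⟨_, hm, by simp⟩
  exact (Set.piecewise_eq_of_notMem _ _ _ hx).trans (Set.piecewise_eq_of_notMem _ _ _ this)

end Exchange

/-! ### Simplicity -/

section Simple

variable {f g h : (ℕ → Bool) ≃ₜ (ℕ → Bool)}

/-- A small cone `c` around a moved point is disjoint from its image. Only its half `c0` is used as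
`a`; the other half `c1` is a cone that avoids both `a` and the image of `a`. -/
theorem exists_displaced_cone (hne : h ≠ 1) : ∃ a b : List Bool, a ≠ [] ∧ b ≠ [] ∧
    Disjoint (range (prepend a)) (h '' range (prepend a)) ∧
    ∀ ψ, prepend b ψ ∉ range (prepend a) ∧ prepend b ψ ∉ h '' range (prepend a) := by
  obtain ⟨x, hx⟩ : ∃ x, h x ≠ x := by
    by_contra! hall
    exact hne (Homeomorph.ext hall)
  obtain ⟨i, hi⟩ := Function.ne_iff.1 hx
  obtain ⟨m, hm⟩ := continuous_iff_cylinder.1 h.continuous x (i + 1)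
  set c := firstDigits x (max m (i + 1)) with hc
  have hdis : ∀ φ ψ, prepend c φ ≠ h (prepend c ψ) := fun φ ψ heq => by
    have h1 := prepend_mem_cylinder x φ (max m (i + 1)) i (by omega)
    have h2 := hm _ (cylinder_anti x (le_max_left _ _)
      (prepend_mem_cylinder x ψ (max m (i + 1)))) i (by omega)
    rw [← hc] at h1 h2
    rw [← heq, h1] at h2
    exact hi h2.symm
  refine ⟨c ++ [false], c ++ [true], by simp, by simp, ?_, fun ψ => ⟨?_, ?_⟩⟩
  · rw [disjoint_left]
    rintro _ ⟨φ, rfl⟩ ⟨_, ⟨ψ, rfl⟩, e⟩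
    rw [prepend_append, prepend_append] at e
    exact hdis _ _ e.symm
  · rintro ⟨φ, e⟩
    rw [prepend_append, prepend_append] at e
    simpa using congrFun (prepend_injective _ e) 0
  · rintro ⟨_, ⟨φ, rfl⟩, e⟩
    rw [prepend_append, prepend_append] at e
    exact hdis _ _ e.symm

theorem Homeomorph.commute_of_disjoint {X : Type*} [TopologicalSpace X] {f g : X ≃ₜ X}
    (hfg : ∀ x, f x = x ∨ g x = x) : Commute f g := by
  have : Equiv.Perm.Disjoint (f.toEquiv : Equiv.Perm X) g.toEquiv := hfg
  exact Homeomorph.ext fun x => DFunLike.congr_fun this.commute.eq x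

/-- The double commutator trick. -/
theorem conePerm_commutator_mem {M : Subgroup ((ℕ → Bool) ≃ₜ (ℕ → Bool))}
    (hM : ∀ g ∈ rationalGroup, ∀ m ∈ M, g * m * g⁻¹ ∈ M) (hh : h ∈ M) {a : List Bool}
    (ha : Disjoint (range (prepend a)) (h '' range (prepend a)))
    (hf : f ∈ rationalGroup) (hg : g ∈ rationalGroup) : conePerm a ⁅f, g⁆ ∈ M := by
  -- The conjugate by `h` is supported in the image of the cone of `a`, which is disjoint from that
  -- cone.
  have hcomm : Commute (conePerm a f) (h * (conePerm a g)⁻¹ * h⁻¹) := by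
    refine Homeomorph.commute_of_disjoint fun x => ?_
    by_cases hx : x ∈ range (prepend a)
    · right
      have : h⁻¹ x ∉ range (prepend a) := fun hm =>
        disjoint_left.1 ha hx ⟨_, hm, h.apply_symm_apply x⟩
      rw [← map_inv, Homeomorph.mul_apply, Homeomorph.mul_apply, conePerm_of_notMem this]
      exact h.apply_symm_apply x
    · exact Or.inl (conePerm_of_notMem hx f)
  set F := conePerm a f
  set G := conePerm a g
  have hk : G * h * G⁻¹ * h⁻¹ ∈ M := M.mul_mem (hM G (conePerm_mem a hg) h hh) (M.inv_mem hh)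
  -- This element is `⁅F, ⁅G, h⁆⁆`. Since `F` commutes with `h * G⁻¹ * h⁻¹`, it equals `⁅F, G⁆`.
  have hk' := M.mul_mem (hM F (conePerm_mem a hf) _ hk) (M.inv_mem hk)
  convert hk' using 1
  rw [map_commutatorElement, commutatorElement_def]
  change F * G * F⁻¹ * G⁻¹ = _
  calc F * G * F⁻¹ * G⁻¹ = F * G * ((h * G⁻¹ * h⁻¹) * F⁻¹ * (h * G⁻¹ * h⁻¹)⁻¹) * G⁻¹ := by
        rw [hcomm.inv_left.symm.mul_inv_cancel]
    _ = _ := by group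

theorem rationalGroup_le_of_normalized {M : Subgroup ((ℕ → Bool) ≃ₜ (ℕ → Bool))}
    (hM : ∀ g ∈ rationalGroup, ∀ m ∈ M, g * m * g⁻¹ ∈ M) (hh : h ∈ M) (hne : h ≠ 1) :
    rationalGroup ≤ M := by
  have conj_iff {g : (ℕ → Bool) ≃ₜ (ℕ → Bool)} (hg : g ∈ rationalGroup) {m : (ℕ → Bool) ≃ₜ (ℕ → Bool)}
      (hm : g * m * g⁻¹ ∈ M) : m ∈ M := by
    simpa [mul_assoc] using hM g⁻¹ (inv_mem hg) _ hm
  have hcone : ∀ f ∈ rationalGroup, conePerm [true] f ∈ M := by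
    intro f hf
    obtain ⟨a, -, -, -, ha, -⟩ := exists_displaced_cone hne
    obtain ⟨F, hF, g, hg, e⟩ := exists_commutator_eq_conePerm hf
    have := conePerm_commutator_mem hM hh ha hF hg
    rw [e, conePerm_conePerm] at this
    obtain ⟨t, ht, ht'⟩ := transit_true (a := a ++ [true, false]) (by simp)
    rw [← conePerm_conj ht']
    exact hM t ht _ this
  have hfix_false : ∀ f ∈ rationalGroup, (∀ ψ, f (prepend [false] ψ) = prepend [false] ψ) →
      f ∈ M := by
    intro f hf hfix
    -- A bijection fixing the cone `0` pointwise maps the cone `1` into itself, hence is `conePerm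
    -- [true]` of its restriction `f'`.
    have hpres {f : (ℕ → Bool) ≃ₜ (ℕ → Bool)} (hfix : ∀ ψ, f (prepend [false] ψ) = prepend [false] ψ)
        (ψ : ℕ → Bool) : prepend [true] (shift 1 (f (prepend [true] ψ))) = f (prepend [true] ψ) := by
      obtain ⟨σ, φ, e⟩ := exists_eq_cons (f (prepend [true] ψ))
      cases σ
      · rw [← hfix φ] at e
        simpa using congrFun (f.injective e) 0
      · rw [e, shift_one_prepend]
    have hfix' : ∀ ψ, f.symm (prepend [false] ψ) = prepend [false] ψ := fun ψ => by
      rw [Homeomorph.symm_apply_eq, hfix]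
    let f' : (ℕ → Bool) ≃ₜ (ℕ → Bool) :=
      { toFun := fun ψ => shift 1 (f (prepend [true] ψ))
        invFun := fun ψ => shift 1 (f.symm (prepend [true] ψ))
        left_inv := fun ψ => by simp [hpres hfix]
        right_inv := fun ψ => by simp [hpres hfix']
        continuous_toFun := (continuous_shift 1).comp (f.continuous.comp (continuous_prepend _))
        continuous_invFun :=
          (continuous_shift 1).comp (f.symm.continuous.comp (continuous_prepend _)) }
    have hf' : f' ∈ rationalGroup :=
      (finiteLocalActions_shift 1).comp (hf.comp (finiteLocalActions_prepend _))
    convert hcone f' hf' using 1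
    ext x : 1
    obtain ⟨σ, φ, rfl⟩ := exists_eq_cons x
    cases σ
    · rw [hfix, conePerm_of_notMem]
      rintro ⟨ψ, e⟩
      simpa using congrFun e 0
    · rw [conePerm_prepend]
      exact (hpres hfix φ).symm
  have hfix : ∀ f ∈ rationalGroup, ∀ b ≠ [], (∀ ψ, f (prepend b ψ) = prepend b ψ) → f ∈ M := by
    intro f hf b hb hfb
    obtain ⟨g, hg, e⟩ := transit hb (b := [false]) (by simp)
    refine conj_iff hg (hfix_false _ (mul_mem (mul_mem hg hf) (inv_mem hg)) fun ψ => ?_)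
    simp [← e, hfb]
  intro f hf
  by_cases hf1 : f = 1
  · exact hf1 ▸ M.one_mem
  obtain ⟨a, b, ha, hb, hd, hab⟩ := exists_displaced_cone hf1
  -- Factor `f = s * (s⁻¹ * f)`: `s` is the identity on the cone of `b`, and `s⁻¹ * f` on the cone
  -- of `a`, where `s` agrees with `f`.
  set s := exchange (isClopen_range_prepend a) hd
  have hs : s ∈ rationalGroup := exchange_mem _ _ hf
  have h1 : s ∈ M := hfix s hs b hb fun ψ =>
    exchange_apply_of_notMem _ _ (hab ψ).1 (hab ψ).2
  have h2 : s⁻¹ * f ∈ M := hfix _ (mul_mem (inv_mem hs) hf) a ha fun ψ => by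
    rw [Homeomorph.mul_apply, Homeomorph.inv_apply, Homeomorph.symm_apply_eq]
    exact (exchange_apply_of_mem _ _ (mem_range_self ψ)).symm
  simpa using M.mul_mem h1 h2

theorem isSimpleGroup_rationalGroup : IsSimpleGroup rationalGroup where
  exists_pair_ne := ⟨⟨flipFirst, flipFirst_mem⟩, 1, fun h => flipFirst_ne_one (congrArg Subtype.val h)⟩
  eq_bot_or_eq_top_of_normal N hN := by
    rw [or_iff_not_imp_left, ← ne_eq, Subgroup.ne_bot_iff_exists_ne_one]
    rintro ⟨⟨h, hh⟩, hne⟩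
    have hle := rationalGroup_le_of_normalized (M := N.map rationalGroup.subtype) (h := h) ?_
      (Subgroup.mem_map_of_mem _ hh) fun e => hne (Subtype.ext (Subtype.ext e))
    · rw [eq_top_iff]
      rintro f -
      obtain ⟨n, hn, e⟩ := hle f.2
      rwa [← Subtype.ext e]
    · rintro g hg _ ⟨m, hm, rfl⟩
      exact ⟨⟨g, hg⟩ * m * ⟨g, hg⟩⁻¹, hN.conj_mem m hm _, rfl⟩

end Simple

/-! ### Eventually periodic points and insertion of periods -/

section TailPeriod

/-- `p` is a period of some tail of `x`. -/
def IsTailPeriod (x : ℕ → Bool) (p : ℕ) : Prop := ∃ N, ∀ m ≥ N, x (m + p) = x m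

/-- `x` has a periodic tail. -/
def EventuallyPeriodic (x : ℕ → Bool) : Prop := ∃ p, 0 < p ∧ IsTailPeriod x p

/-- The least positive period of the tails of `x`. -/
noncomputable def tailPeriod (x : ℕ → Bool) : ℕ := sInf {p | 0 < p ∧ IsTailPeriod x p}

/-- The least position from which on `x` is periodic. -/
noncomputable def preperiod (x : ℕ → Bool) : ℕ := sInf {N | ∀ m ≥ N, x (m + tailPeriod x) = x m}

theorem apply_add_mul {x : ℕ → Bool} {N p : ℕ} (h : ∀ m ≥ N, x (m + p) = x m) (k : ℕ) {m : ℕ}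
    (hm : N ≤ m) : x (m + k * p) = x m := by
  induction k with
  | zero => simp
  | succ k ih => rw [add_mul, one_mul, ← add_assoc, h _ (by omega), ih]

namespace EventuallyPeriodic

variable {x : ℕ → Bool}

theorem tailPeriod_pos (hx : EventuallyPeriodic x) : 0 < tailPeriod x := (Nat.sInf_mem hx).1

theorem isTailPeriod (hx : EventuallyPeriodic x) : IsTailPeriod x (tailPeriod x) :=
  (Nat.sInf_mem hx).2

theorem apply_add (hx : EventuallyPeriodic x) (k : ℕ) {m : ℕ} (hm : preperiod x ≤ m) :
    x (m + k * tailPeriod x) = x m :=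
  apply_add_mul (Nat.sInf_mem hx.isTailPeriod) k hm

/-- Otherwise the remainder of `p` would be a smaller positive tail period. -/
theorem tailPeriod_dvd (hx : EventuallyPeriodic x) {p : ℕ} (hp : IsTailPeriod x p) :
    tailPeriod x ∣ p := by
  rw [Nat.dvd_iff_mod_eq_zero]
  by_contra hne
  obtain ⟨N, hN⟩ := hp
  have hmem : p % tailPeriod x ∈ {p | 0 < p ∧ IsTailPeriod x p} := by
    refine ⟨Nat.pos_of_ne_zero hne, max N (preperiod x), fun m hm => ?_⟩
    rw [← hx.apply_add (p / tailPeriod x) (by omega), add_assoc, mul_comm, Nat.mod_add_div,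
      hN m (by omega)]
  exact absurd (Nat.sInf_le hmem) (not_le.2 (Nat.mod_lt _ hx.tailPeriod_pos))

end EventuallyPeriodic

/-- Insertion of `k` periods of `x` into the sequences near `x`. -/
noncomputable def insertPeriods (x : ℕ → Bool) (k : ℕ) (z : ℕ → Bool) : ℕ → Bool := fun m =>
  if m < preperiod x + k * tailPeriod x then x m else z (m - k * tailPeriod x)

variable {x z : ℕ → Bool}

theorem cylinder_mem_nhds (x : ℕ → Bool) (n : ℕ) : cylinder x n ∈ 𝓝 x :=
  (nhds_hasBasis_cylinder x).mem_of_mem trivial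

theorem insertPeriods_insertPeriods (hx : EventuallyPeriodic x) (k l : ℕ) (z : ℕ → Bool) :
    insertPeriods x k (insertPeriods x l z) = insertPeriods x (k + l) z := by
  ext m
  simp only [insertPeriods, add_mul]
  split_ifs
  · rfl
  · omega
  · rw [← hx.apply_add k (by omega)]; congr 1; omega
  · omega
  · omega
  · congr 1; omega

theorem insertPeriods_zero {z : ℕ → Bool} (hz : z ∈ cylinder x (preperiod x)) :
    insertPeriods x 0 z = z := by
  ext m
  simp only [insertPeriods, zero_mul, add_zero]
  split_ifs with h
  · exact (hz m h).symm
  · rfl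

theorem insertPeriods_mem_cylinder (hx : EventuallyPeriodic x) (k : ℕ) {n : ℕ}
    (hz : z ∈ cylinder x n) : insertPeriods x k z ∈ cylinder x n := by
  intro m hm
  simp only [insertPeriods]
  split_ifs with h
  · rfl
  · rw [hz _ (by omega), ← hx.apply_add k (by omega)]; congr 1; omega

theorem tendsto_insertPeriods (hx : EventuallyPeriodic x) (k : ℕ) :
    Tendsto (insertPeriods x k) (𝓝 x) (𝓝 x) := by
  rw [(nhds_hasBasis_cylinder x).tendsto_iff (nhds_hasBasis_cylinder x)]
  exact fun n _ => ⟨n, trivial, fun z hz => insertPeriods_mem_cylinder hx k hz⟩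

/-- The germ of the insertion determines the number of periods: flip one remote digit of `x` and see
where the flip is moved. -/
theorem le_of_insertPeriods_eq (hx : EventuallyPeriodic x) {a b : ℕ}
    (h : ∀ᶠ z in 𝓝 x, insertPeriods x a z = insertPeriods x b z) : b ≤ a := by
  by_contra! hab
  obtain ⟨n, -, hn⟩ := (nhds_hasBasis_cylinder x).eventually_iff.1 h
  obtain ⟨d, rfl⟩ := Nat.exists_eq_add_of_lt hab
  set N := max n (preperiod x) + (d + 1) * tailPeriod x with hN
  have hpos : 0 < (d + 1) * tailPeriod x := Nat.mul_pos (by omega) hx.tailPeriod_pos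
  set z := Function.update x N (!x N)
  have hz : z ∈ cylinder x N := update_mem_cylinder x N _
  have key := congrFun (hn (cylinder_anti x (by omega) hz)) (N + a * tailPeriod x)
  have hb : (a + d + 1) * tailPeriod x = a * tailPeriod x + (d + 1) * tailPeriod x := by ring
  simp only [insertPeriods, hb] at key
  rw [if_neg (by omega), Nat.add_sub_cancel] at key
  have hzN : z N = !x N := by simp [z]
  have hxN : x (N + a * tailPeriod x) = x N := hx.apply_add a (by omega)
  split_ifs at key with hlt
  · rw [hzN, hxN] at key
    simp at key
  · have hx' := hx.apply_add (d + 1)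
      (m := N + a * tailPeriod x - (a * tailPeriod x + (d + 1) * tailPeriod x)) (by omega)
    rw [show N + a * tailPeriod x - (a * tailPeriod x + (d + 1) * tailPeriod x) +
      (d + 1) * tailPeriod x = N by omega] at hx'
    rw [hzN, hz _ (by omega), ← hx'] at key
    simp at key

end TailPeriod

/-! ### Rates at eventually periodic points -/

section Rate

/-- Near `x`, the map `f` turns `j` additional periods of `x` into `i` additional periods of
`f x`. -/
def HasRate (f : (ℕ → Bool) → ℕ → Bool) (x : ℕ → Bool) (j i : ℕ) : Prop :=
  ∀ᶠ z in 𝓝 x, f (insertPeriods x j z) = insertPeriods (f x) i (f z)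

namespace HasRate

variable {f g : (ℕ → Bool) ≃ₜ (ℕ → Bool)} {x : ℕ → Bool} {j i j' i' k : ℕ}

theorem mul_left (hx : EventuallyPeriodic x) (hy : EventuallyPeriodic (f x))
    (h : HasRate f x j i) (n : ℕ) : HasRate f x (n * j) (n * i) := by
  induction n with
  | zero =>
    filter_upwards [cylinder_mem_nhds x (preperiod x),
      f.continuous.continuousAt (cylinder_mem_nhds (f x) (preperiod (f x)))] with z hz hz'
    rw [zero_mul, zero_mul, insertPeriods_zero hz, insertPeriods_zero hz']
  | succ n ih =>
    filter_upwards [ih, (tendsto_insertPeriods hx (n * j)).eventually h] with z h1 h2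
    rw [add_mul, one_mul, add_comm, ← insertPeriods_insertPeriods hx, h2, h1,
      insertPeriods_insertPeriods hy, add_mul, one_mul, add_comm]

theorem comp (hx : EventuallyPeriodic x) (hy : EventuallyPeriodic (f x))
    (hz : EventuallyPeriodic (g (f x))) (h : HasRate f x j i) (h' : HasRate g (f x) i' k) :
    HasRate ⇑(g * f) x (i' * j) (i * k) := by
  filter_upwards [h.mul_left hx hy i',
    f.continuous.continuousAt.eventually (h'.mul_left hy hz i)] with z h1 h2
  simp only [Homeomorph.mul_apply]
  rw [h1, mul_comm i' i, h2]

theorem symm (h : HasRate f x j i) : HasRate f.symm (f x) i j := by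
  have ht : Tendsto f.symm (𝓝 (f x)) (𝓝 x) := by
    simpa using f.symm.continuous.tendsto (f x)
  filter_upwards [ht.eventually h] with y hy
  rw [f.symm_apply_apply, Homeomorph.symm_apply_eq, hy, f.apply_symm_apply]

theorem eq_of_eq (hy : EventuallyPeriodic (f x)) (h : HasRate f x j i) (h' : HasRate f x j i') :
    i = i' := by
  have ht : Tendsto f.symm (𝓝 (f x)) (𝓝 x) := by
    simpa using f.symm.continuous.tendsto (f x)
  have key : ∀ᶠ y in 𝓝 (f x), insertPeriods (f x) i y = insertPeriods (f x) i' y := by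
    filter_upwards [ht.eventually (h.and h')] with y hy
    simpa using hy.1.symm.trans hy.2
  exact le_antisymm (le_of_insertPeriods_eq hy (key.mono fun _ => Eq.symm))
    (le_of_insertPeriods_eq hy key)

/-- The ratio `i / j` is an invariant of the germ of `f` at `x`. -/
theorem mul_eq_mul (hx : EventuallyPeriodic x) (hy : EventuallyPeriodic (f x))
    (h : HasRate f x j i) (h' : HasRate f x j' i') : j' * i = j * i' :=
  eq_of_eq hy (h.mul_left hx hy j') (mul_comm j j' ▸ h'.mul_left hx hy j)

end HasRate

variable {f : (ℕ → Bool) ≃ₜ (ℕ → Bool)} {x : ℕ → Bool}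

theorem insertPeriods_eq_prepend {z : ℕ → Bool} (hx : EventuallyPeriodic x) {n : ℕ}
    (hn : preperiod x ≤ n) (k : ℕ) (hz : z ∈ cylinder x n) :
    insertPeriods x k z = prepend (firstDigits x (n + k * tailPeriod x)) (shift n z) := by
  ext m
  rw [prepend_firstDigits_apply]
  simp only [insertPeriods, shift]
  split_ifs
  · rfl
  · omega
  · rw [hz _ (by omega), ← hx.apply_add k (by omega)]; congr 1; omega
  · congr 1; omega

/-- Equal local actions before and after `j` periods of `x` mean that these periods only lengthen
the common output, from `c` to `c'` digits. As the tails of `x` also coincide there, `c' - c` is a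
tail period of `f x`, so a multiple of the least one. -/
theorem exists_hasRate_of_localAction_eq (hx : EventuallyPeriodic x) {n j : ℕ}
    (hn : preperiod x ≤ n) (hj : 0 < j)
    (he : localAction f (firstDigits x n) =
      localAction f (firstDigits x (n + j * tailPeriod x))) :
    EventuallyPeriodic (f x) ∧ ∃ i, 0 < i ∧ HasRate f x j i := by
  have hjp : 0 < j * tailPeriod x := Nat.mul_pos hj hx.tailPeriod_pos
  set n' := n + j * tailPeriod x with hn'
  set h := localAction f (firstDigits x n) with hh
  set c := commonLength (f ∘ prepend (firstDigits x n)) with hc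
  set c' := commonLength (f ∘ prepend (firstDigits x n')) with hc'
  have hξ : shift n' x = shift n x := by
    ext m
    simp only [shift, hn', add_right_comm n]
    exact hx.apply_add j (by omega)
  have hP (k : ℕ) : commonPrefix (f ∘ prepend (firstDigits x k)) =
      firstDigits (f x) (commonLength (f ∘ prepend (firstDigits x k))) := by
    have := prepend_localAction (f := f) (firstDigits x k) (shift k x)
    rw [prepend_firstDigits_shift] at this
    rw [← this, ← length_commonPrefix, firstDigits_prepend]
  have hf (φ : ℕ → Bool) : f (prepend (firstDigits x n) φ) = prepend (firstDigits (f x) c) (h φ) := by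
    rw [← hP, prepend_localAction]
  have hf' (φ : ℕ → Bool) :
      f (prepend (firstDigits x n') φ) = prepend (firstDigits (f x) c') (h φ) := by
    rw [← hP, he, prepend_localAction]
  have hle : c ≤ c' := by
    have : firstDigits x n' = firstDigits x n ++ firstDigits (shift n x) (n' - n) := by
      rw [← firstDigits_prepend_add, prepend_firstDigits_shift, length_firstDigits]
      congr 1; omega
    rw [hc', this, comp_prepend_append, commonLength_prepend, length_commonPrefix]
    · exact Nat.le_add_right _ _
    · exact (localAction_injective f.injective _).comp (prepend_injective _)
  have hlt : c < c' := by
    -- If the periods produced no output, `f` would identify two sequences that differ at position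
    -- `n`.
    refine lt_of_le_of_ne hle fun heq => ?_
    have h1 := (hf fun _ => !x n).trans (heq ▸ (hf' fun _ => !x n).symm)
    have h2 := congrFun (f.injective h1) n
    rw [prepend_firstDigits_apply, prepend_firstDigits_apply, if_neg (by omega),
      if_pos (by omega)] at h2
    simp at h2
  have hyc {m : ℕ} (hm : c ≤ m) : f x m = h (shift n x) (m - c) := by
    have := congrFun (hf (shift n x)) m
    rwa [prepend_firstDigits_shift, prepend_firstDigits_apply, if_neg (by omega)] at this
  have hyc' {m : ℕ} (hm : c' ≤ m) : f x m = h (shift n x) (m - c') := by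
    have := congrFun (hf' (shift n' x)) m
    rwa [prepend_firstDigits_shift, prepend_firstDigits_apply, if_neg (by omega), hξ] at this
  have hper : IsTailPeriod (f x) (c' - c) := ⟨c, fun m hm => by
    rw [hyc hm, hyc' (by omega)]; congr 1; omega⟩
  have hy : EventuallyPeriodic (f x) := ⟨c' - c, by omega, hper⟩
  obtain ⟨i, hi⟩ := hy.tailPeriod_dvd hper
  rw [mul_comm] at hi
  refine ⟨hy, i, Nat.pos_of_ne_zero fun h0 => by simp [h0] at hi; omega, ?_⟩
  -- Continuity handles the initial digits, where the inserted sequence is copied from `f x`; the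
  -- local action handles the rest.
  have ht : Tendsto (fun z => f (insertPeriods x j z)) (𝓝 x) (𝓝 (f x)) :=
    f.continuous.continuousAt.tendsto.comp (tendsto_insertPeriods hx j)
  filter_upwards [cylinder_mem_nhds x n, ht (cylinder_mem_nhds (f x) (preperiod (f x) + (c' - c)))]
    with z hz hz'
  have hzn : z = prepend (firstDigits x n) (shift n z) := by
    rw [← firstDigits_eq_iff.2 hz, prepend_firstDigits_shift]
  ext m
  by_cases hm : m < preperiod (f x) + (c' - c)
  · rw [insertPeriods, ← hi, if_pos hm]
    exact hz' m hm
  · rw [insertPeriods, ← hi, if_neg hm, insertPeriods_eq_prepend hx hn j hz, hf']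
    conv_rhs => rw [hzn, hf]
    rw [prepend_firstDigits_apply, prepend_firstDigits_apply]
    by_cases hmc : m < c'
    · have hym := hy.apply_add i (m := m - (c' - c)) (by omega)
      rw [← hi, show m - (c' - c) + (c' - c) = m by omega] at hym
      rw [if_pos hmc, if_pos (by omega), hym]
    · rw [if_neg hmc, if_neg (by omega)]
      congr 1; omega

/-- Pigeonhole over the prefixes of `x` that end after whole periods; `B` is the number of local
actions, independent of `x`. -/
theorem exists_hasRate (hf : FiniteLocalActions f) : ∃ B, ∀ x, EventuallyPeriodic x →
    EventuallyPeriodic (f x) ∧ ∃ j i, 0 < j ∧ j ≤ B ∧ 0 < i ∧ HasRate f x j i := by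
  have hfin := hf.finite_range f.injective
  refine ⟨hfin.toFinset.card, fun x hx => ?_⟩
  obtain ⟨a, ha, b, hb, hne, he⟩ := Finset.exists_ne_map_eq_of_card_lt_of_maps_to
    (s := Finset.range (hfin.toFinset.card + 1)) (t := hfin.toFinset) (by simp)
    (f := fun k => localAction f (firstDigits x (preperiod x + k * tailPeriod x)))
    (fun k _ => by simp)
  wlog hab : a < b generalizing a b
  · exact this b hb a ha hne.symm he.symm (by omega)
  rw [Finset.mem_range] at hb
  obtain ⟨d, rfl⟩ := Nat.exists_eq_add_of_lt hab
  obtain ⟨hy, i, hi, hr⟩ := exists_hasRate_of_localAction_eq (f := f) hx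
    (n := preperiod x + a * tailPeriod x) (j := d + 1) (by omega) (by omega) (by
      rw [he]; congr 2; ring)
  exact ⟨hy, d + 1, i, by omega, by omega, hi, hr⟩

/-- The rational homeomorphisms whose rates are units at the prime `p`. -/
def rateUnits (p : ℕ) [Fact p.Prime] : Subgroup ((ℕ → Bool) ≃ₜ (ℕ → Bool)) where
  carrier := {f | f ∈ rationalGroup ∧ ∀ x, EventuallyPeriodic x →
    ∃ j i, 0 < j ∧ 0 < i ∧ HasRate f x j i ∧ padicValNat p i = padicValNat p j}
  mul_mem' := by
    rintro g f ⟨hg, hg'⟩ ⟨hf, hf'⟩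
    refine ⟨mul_mem hg hf, fun x hx => ?_⟩
    obtain ⟨B, hB⟩ := exists_hasRate hf
    obtain ⟨C, hC⟩ := exists_hasRate hg
    have hy := (hB x hx).1
    have hz := (hC _ hy).1
    obtain ⟨j, i, hj, hi, hr, hv⟩ := hf' x hx
    obtain ⟨i', k, hi', hk, hr', hv'⟩ := hg' _ hy
    refine ⟨i' * j, i * k, Nat.mul_pos hi' hj, Nat.mul_pos hi hk, hr.comp hx hy hz hr', ?_⟩
    rw [padicValNat.mul hi.ne' hk.ne', padicValNat.mul hi'.ne' hj.ne', hv, hv', add_comm]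
  one_mem' := ⟨one_mem _, fun x _ => ⟨1, 1, one_pos, one_pos, Eventually.of_forall fun _ => rfl, rfl⟩⟩
  inv_mem' := by
    rintro f ⟨hf, hf'⟩
    refine ⟨inv_mem hf, fun y hy => ?_⟩
    obtain ⟨B, hB⟩ := exists_hasRate hf.symm
    obtain ⟨j, i, hj, hi, hr, hv⟩ := hf' _ (hB y hy).1
    have := hr.symm
    rw [f.apply_symm_apply] at this
    exact ⟨i, j, hi, hj, this, hv.symm⟩

/-- The bound for `f` controls only `j`. Applied to `f⁻¹` it controls the numerator `i'` of another
rate of `f` at `x`. As `j' * i = j * i'`, a prime above both bounds does not divide `i` either. -/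
theorem exists_forall_mem_rateUnits (hf : f ∈ rationalGroup) :
    ∃ B, ∀ (p : ℕ) [Fact p.Prime], B < p → f ∈ rateUnits p := by
  obtain ⟨B, hB⟩ := exists_hasRate hf
  obtain ⟨C, hC⟩ := exists_hasRate hf.symm
  refine ⟨max B C, fun p _ hp => ⟨hf, fun x hx => ?_⟩⟩
  obtain ⟨hy, j, i, hj, hjB, hi, hr⟩ := hB x hx
  obtain ⟨-, i', j', hi', hiC, hj', hr'⟩ := hC _ hy
  have hr'' := hr'.symm
  simp only [Homeomorph.symm_symm, f.symm_apply_apply] at hr''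
  have hv := congrArg (padicValNat p) (hr.mul_eq_mul hx hy hr'')
  rw [padicValNat.mul hj'.ne' hi.ne', padicValNat.mul hj.ne' hi'.ne',
    padicValNat.eq_zero_of_not_dvd (Nat.not_dvd_of_pos_of_lt hj (by omega)),
    padicValNat.eq_zero_of_not_dvd (Nat.not_dvd_of_pos_of_lt hi' (by omega))] at hv
  refine ⟨j, i, hj, hi, hr, ?_⟩
  rw [padicValNat.eq_zero_of_not_dvd (n := j) (Nat.not_dvd_of_pos_of_lt hj (by omega))]
  omega

end Rate

/-! ### Homeomorphisms with rate `k + 1` -/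

section Stretch

/-- The map `1ᵐ0ψ ↦ 1ᵐ0ψ` for `m < k`, `1ᵏψ ↦ 1ᵏ0ψ`. -/
def insertFalse : ℕ → (ℕ → Bool) → ℕ → Bool
  | 0 => prepend [false]
  | k + 1 => branch fun σ => match σ with
    | false => prepend [false]
    | true => prepend [true] ∘ insertFalse k

theorem finiteLocalActions_insertFalse (k : ℕ) : FiniteLocalActions (insertFalse k) := by
  induction k with
  | zero => exact finiteLocalActions_prepend _
  | succ k ih =>
    exact finiteLocalActions_branch fun σ => match σ with
      | false => finiteLocalActions_prepend _
      | true => (finiteLocalActions_prepend _).comp ih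

theorem continuous_insertFalse (k : ℕ) : Continuous (insertFalse k) := by
  induction k with
  | zero => exact continuous_prepend _
  | succ k ih =>
    exact continuous_branch fun σ => match σ with
      | false => continuous_prepend _
      | true => (continuous_prepend _).comp ih

theorem insertFalse_succ_false (k : ℕ) (ψ : ℕ → Bool) :
    insertFalse (k + 1) (prepend [false] ψ) = prepend [false] ψ := by
  simp [insertFalse]

theorem insertFalse_succ_true (k : ℕ) (ψ : ℕ → Bool) :
    insertFalse (k + 1) (prepend [true] ψ) = prepend [true] (insertFalse k ψ) := by
  simp [insertFalse]

theorem prepend_singleton_inj {σ τ : Bool} {φ ψ : ℕ → Bool} :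
    prepend [σ] φ = prepend [τ] ψ ↔ σ = τ ∧ φ = ψ := by
  constructor
  · intro h
    obtain rfl : σ = τ := by simpa using congrFun h 0
    exact ⟨rfl, prepend_injective _ h⟩
  · rintro ⟨rfl, rfl⟩; rfl

theorem insertFalse_injective (k : ℕ) : Function.Injective (insertFalse k) := by
  induction k with
  | zero => exact prepend_injective _
  | succ k ih =>
    intro x y hxy
    obtain ⟨σ, φ, rfl⟩ := exists_eq_cons x
    obtain ⟨τ, ψ, rfl⟩ := exists_eq_cons y
    cases σ <;> cases τ <;>
      simp only [insertFalse_succ_false, insertFalse_succ_true, prepend_singleton_inj] at hxy ⊢ <;>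
      simp_all [ih.eq_iff]

/-- This is the condition on `e` that makes `ladder (k + 1) e` bijective. -/
theorem range_insertFalse (k : ℕ) :
    range (insertFalse k) = (range (prepend (List.replicate (k + 1) true)))ᶜ := by
  induction k with
  | zero =>
    ext x
    simp only [insertFalse, mem_compl_iff, mem_range_prepend]
    cases h : x 0 <;> simp [firstDigits, h]
  | succ k ih =>
    ext x
    obtain ⟨σ, φ, rfl⟩ := exists_eq_cons x
    have hφ : φ ∈ range (insertFalse k) ↔ _ := Set.ext_iff.1 ih φ
    rw [mem_compl_iff] at hφ ⊢
    have hrep (z : ℕ → Bool) : prepend (List.replicate (k + 1 + 1) true) z =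
        prepend [true] (prepend (List.replicate (k + 1) true) z) := by
      rw [List.replicate_succ, prepend_cons]
    cases σ
    · refine iff_of_true ⟨_, insertFalse_succ_false k φ⟩ ?_
      rintro ⟨z, hz⟩
      rw [hrep, prepend_singleton_inj] at hz
      simp at hz
    · have h1 : prepend [true] φ ∈ range (insertFalse (k + 1)) ↔ φ ∈ range (insertFalse k) := by
        constructor
        · rintro ⟨y, hy⟩
          obtain ⟨τ, ψ, rfl⟩ := exists_eq_cons y
          cases τ
          · rw [insertFalse_succ_false, prepend_singleton_inj] at hy
            simp at hy
          · rw [insertFalse_succ_true, prepend_singleton_inj] at hy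
            exact ⟨ψ, hy.2⟩
        · rintro ⟨ψ, rfl⟩
          exact ⟨_, insertFalse_succ_true k ψ⟩
      rw [h1, hφ, not_iff_not, mem_range, mem_range]
      simp [hrep, prepend_singleton_inj]

/-- A rational homeomorphism with `1ψ ↦ 1ᵏ⁺¹f(ψ)`. -/
noncomputable def stretch (k : ℕ) : (ℕ → Bool) ≃ₜ (ℕ → Bool) :=
  ladderHomeo k.succ_pos (continuous_insertFalse k) (insertFalse_injective k) (range_insertFalse k)

theorem stretch_mem (k : ℕ) : stretch k ∈ rationalGroup :=
  finiteLocalActions_ladder (finiteLocalActions_insertFalse k)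

theorem tailPeriod_const : tailPeriod (fun _ => true) = 1 := by
  have hx : EventuallyPeriodic fun _ => true := ⟨1, one_pos, 0, fun _ _ => rfl⟩
  exact Nat.dvd_one.1 (hx.tailPeriod_dvd ⟨0, fun _ _ => rfl⟩)

theorem insertPeriods_const (k : ℕ) (z : ℕ → Bool) :
    insertPeriods (fun _ => true) k z = prepend (List.replicate k true) z := by
  have h0 : preperiod (fun _ => true) = 0 := Nat.sInf_eq_zero.2 (Or.inl fun _ _ => rfl)
  ext m
  simp [insertPeriods, prepend, tailPeriod_const, h0]

theorem stretch_const (k : ℕ) : stretch k (fun _ => true) = fun _ => true := ladder_const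

theorem hasRate_stretch (k : ℕ) : HasRate (stretch k) (fun _ => true) 1 (k + 1) := by
  refine Eventually.of_forall fun z => ?_
  rw [stretch_const, insertPeriods_const, insertPeriods_const]
  exact ladder_true z

theorem stretch_notMem (k : ℕ) [Fact (k + 1).Prime] : stretch k ∉ rateUnits (k + 1) := by
  rintro ⟨-, h⟩
  have hx : EventuallyPeriodic fun _ => true := ⟨1, one_pos, 0, fun _ _ => rfl⟩
  obtain ⟨j, i, hj, hi, hr, hv⟩ := h _ hx
  have key := hr.mul_eq_mul hx ((stretch_const k).symm ▸ hx) (hasRate_stretch k)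
  rw [one_mul] at key
  rw [key, padicValNat.mul hj.ne' (by omega), padicValNat_self] at hv
  omega

end Stretch

/-! ### Infinite generation -/

theorem not_fg_rationalGroup : ¬ Group.FG rationalGroup := by
  rw [Group.fg_iff_subgroup_fg, Subgroup.fg_iff]
  rintro ⟨S, hS, hfin⟩
  have hmem : ∀ f ∈ S, f ∈ rationalGroup := fun f hf => hS ▸ Subgroup.subset_closure hf
  choose! B hB using fun f hf => exists_forall_mem_rateUnits (hmem f hf)
  obtain ⟨M, hM⟩ := (hfin.image B).bddAbove
  -- For a prime above the bounds of all generators, the whole group would lie in `rateUnits p`, but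
  -- `stretch (p - 1)` does not.
  obtain ⟨p, hp, hprime⟩ := Nat.exists_infinite_primes (M + 1)
  obtain ⟨k, rfl⟩ := Nat.exists_eq_add_of_lt hprime.pos
  rw [zero_add] at *
  have : Fact (k + 1).Prime := ⟨hprime⟩
  have hle : rationalGroup ≤ rateUnits (k + 1) := by
    rw [← hS, Subgroup.closure_le]
    exact fun f hf => hB f hf _ ((hM (mem_image_of_mem B hf)).trans_lt (by omega))
  exact stretch_notMem k (hle (stretch_mem k))

/-- The rational homeomorphisms of `{0,1}^ω` form a group `R` under composition, and this group
is simple but not finitely generated. -/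
theorem theorem1 :
    ∃ R : Subgroup ((ℕ → Bool) ≃ₜ (ℕ → Bool)),
      (∀ f : (ℕ → Bool) ≃ₜ (ℕ → Bool), f ∈ R ↔ IsRationalHomeo f) ∧
        IsSimpleGroup R ∧ ¬ Group.FG R :=
  ⟨rationalGroup, fun _ => isRationalHomeo_iff.symm, isSimpleGroup_rationalGroup,
    not_fg_rationalGroup⟩
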